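/- For distributions $P,Q$ on a countable set let $d_{TV}(P,Q)=\frac12\sum_x|P(x)-Q(x)|$. A probability distribution $p$ on $[n]=\{1,\dots,n\}$ is $T$-big if $p(i)\ge T$ for every $i\in[n]$, and it is $\epsilon$-far from $T$-big if $\inf\{d_{TV}(p,q): q \text{ is } T\text{-big}\}\ge\epsilon$ (where the set of $T$-big distributions on $[n]$ is nonempty). The histogram of a sequence of samples in $[n]$ is the vector $h\in\mathbb{N}^n$ whose $i$-th entry is the number of occurrences of $i$; its size is the number of samples. For a class $\mathcal P$ of distributions on $[n]$, a distribution $\mathcal H$ over histograms is said to generate histograms of size at least $s$ drawn from distributions in $\mathcal P$ if there is a (discrete) joint distribution of a pair $(p,m)$ with $p\in\mathcal P$ and $m\ge s$ always, such that $\mathcal H$ is the law of the histogram $h$ obtained by first drawing $(p,m)$ and then taking $m$ independent samples from $p$. **Theorem.** There are an absolute constant $\epsilon_0>0$ and a function $\beta=\beta(L,\epsilon)$ such that for all constants $A,B,c>0$ there are constants $a,C>0$ and $n_0\in\mathbb{N}$ for which the following holds. Let $n\ge n_0$ be an integer, $L$ a positive integer with $L\le A\log n$, and $\epsilon$ a real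 number with $c/n\le\epsilon\le\epsilon_0$ and $\log(1/\epsilon)\le B\,L$. Put $$T=\frac{1}{\beta(L,\epsilon)\,n},\qquad s=a\,\frac{n^{1-1/L}\log^2(1/\epsilon)}{L},\qquad p_{\max}=C\,\frac{L^2}{n\log^2(1/\epsilon)} .$$ Then $\beta(L,\epsilon)>0$, and there are two distributions $\mathcal H^+$ and $\mathcal H^-$ over histograms such that - $\mathcal H^+$ generates histograms of size at least $s$ drawn from $T$-big distributions on $[n]$ in which every element has mass at most $p_{\max}$; - $\mathcal H^-$ generates histograms of size at least $s$ drawn from distributions on $[n]$ that are $\epsilon$-far from $T$-big and in which every element has mass at most $p_{\max}$; - $d_{TV}(\mathcal H^+,\mathcal H^-)\le 0.01$. -/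

import Mathlib

noncomputable section

/-- Total variation distance between two discrete probability distributions,
`(1/2) ∑ₓ |P(x) - Q(x)|`. -/
def tvDist {α : Type*} (P Q : PMF α) : ℝ :=
  (1 / 2) * ∑' x, |(P x).toReal - (Q x).toReal|

/-- A distribution on `[n]` is `T`-big if every element has mass at least `T`. -/
def IsBig {n : ℕ} (T : ℝ) (p : PMF (Fin n)) : Prop :=
  ∀ i, T ≤ (p i).toReal

/-- The distance of `p` to the set of `T`-big distributions on `[n]`. -/
def distToBig {n : ℕ} (T : ℝ) (p : PMF (Fin n)) : ℝ :=
  ⨅ q : {q : PMF (Fin n) // IsBig T q}, tvDist p q.1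

/-- `p` is `ε`-far from `T`-big. For `ε > 0` this forces the set of `T`-big distributions to be
nonempty, since the infimum of the empty family of reals is `0`. -/
def IsFarFromBig {n : ℕ} (ε T : ℝ) (p : PMF (Fin n)) : Prop :=
  ε ≤ distToBig T p

/-- The joint law of `m` independent samples from `p`. -/
def iidSamples {α : Type*} (p : PMF α) : (m : ℕ) → PMF (Fin m → α)
  | 0 => PMF.pure Fin.elim0
  | m + 1 => p.bind fun a => (iidSamples p m).map fun x => (Fin.cons a x : Fin (m + 1) → α)

/-- The histogram of a sequence of samples: entry `i` is the number of occurrences of `i`. -/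
def histogram {n m : ℕ} (x : Fin m → Fin n) : Fin n → ℕ :=
  fun i => (Finset.univ.filter fun j => x j = i).card

/-- The law of the histogram of `m` independent samples from `p`. -/
def histogramOf {n : ℕ} (p : PMF (Fin n)) (m : ℕ) : PMF (Fin n → ℕ) :=
  (iidSamples p m).map histogram

/-- `H` is the law of a histogram generated in two steps: first draw, from some joint law `D`, a
distribution `p` in the class `S` and a number `m ≥ s` of samples; then output the histogram of `m`
independent samples from `p`. -/
def IsHistogramLaw {n : ℕ} (S : Set (PMF (Fin n))) (s : ℝ) (H : PMF (Fin n → ℕ)) : Prop :=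
  ∃ D : PMF (PMF (Fin n) × ℕ),
    (∀ pm ∈ D.support, pm.1 ∈ S ∧ s ≤ (pm.2 : ℝ)) ∧
    H = D.bind fun pm => histogramOf pm.1 pm.2

end

/-! The proof is moment matching on top of Poissonization. Draw n independent scores from one of two
laws on [0, b] with equal moments up to order L and common mean in [1, 2]: the plus law lives on [1,
b], the minus law has an atom of mass at least q at 0. Normalizing the scores gives p. With high
probability the total score is between n/4 and 5n, so every mass is at most 4b/n, a plus p is
1/(5n)-big, and a minus p has at least nq/4 zeros, hence is q/20-far.

The number of samples may depend on p, so take it Poisson with mean ρ times the total score. The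
normalization then cancels and the histogram entries become independent Poisson mixtures. Matched
moments bring the two mixtures within 2(3ρb)^(L+1)/(L+1)! in ℓ¹
(`tsum_abs_sum_mul_poissonWeight_le`), which survives summation over n coordinates when ρb is a
small multiple of L n^(-1/(L+1)).

The quantitative core is `exists_isMatchedPair`, with b = r² and q = exp(-(4L/r + 6)). A signed
measure on [1, b] that evaluates low-degree polynomials at the exterior point 0 is obtained from
Chebyshev extrapolation, whose cost is exponential only in L/√b. A nonnegative damping polynomial of
degree about r keeps the mean bounded without losing a power of b in q. Taking r of order L/log(1/ε)
gives q ≥ 20ε and the stated s and p_max. -/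

/-! ### Chebyshev extrapolation and moment-matched pairs. -/

open Polynomial in
-- The weights are the Lagrange basis polynomials at `a`. Outside [-1, 1] their signs alternate
-- exactly as the values ±1 of T_D at its extremal nodes, so evaluating T_D at `a` adds up the
-- absolute values.
theorem exists_chebyshev_extrapolation_weights (D : ℕ) {a : ℝ} (ha : 1 < a) :
    ∃ l : ℕ → ℝ, (∀ P : ℝ[X], P.natDegree ≤ D →
      P.eval a = ∑ i ∈ Finset.range (D + 1), l i * P.eval (Polynomial.Chebyshev.node D i)) ∧
      ∑ i ∈ Finset.range (D + 1), |l i| = (Polynomial.Chebyshev.T ℝ D).eval a := by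
  set v := Polynomial.Chebyshev.node D
  set s := Finset.range (D + 1) with hs
  have hinj : Set.InjOn v s := (Polynomial.Chebyshev.strictAntiOn_node D).injOn
  let l : ℕ → ℝ := fun i =>
    (∏ j ∈ s.erase i, (a - v j)) / ∏ j ∈ s.erase i, (v i - v j)
  have hl : ∀ P : ℝ[X], P.natDegree ≤ D → P.eval a = ∑ i ∈ s, l i * P.eval (v i) := by
    intro P hP
    have hdeg : P.degree < (s.card : ℕ) := by
      rw [hs, Finset.card_range]
      exact lt_of_le_of_lt degree_le_natDegree (by exact_mod_cast Nat.lt_succ_of_le hP)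
    conv_lhs => rw [Lagrange.eq_interpolate hinj hdeg]
    rw [Lagrange.interpolate_apply, eval_finsetSum]
    refine Finset.sum_congr rfl fun i _ => ?_
    simp only [eval_mul, eval_C, Lagrange.basis, Lagrange.basisDivisor, eval_prod, eval_sub,
      eval_X, l, Finset.prod_mul_distrib, Finset.prod_inv_distrib]
    ring
  refine ⟨l, hl, ?_⟩
  rw [hl _ (by simp [Polynomial.Chebyshev.natDegree_T])]
  refine Finset.sum_congr rfl fun i hi => ?_
  have hi' : i ≤ D := Nat.lt_succ_iff.mp (Finset.mem_range.mp hi)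
  rw [Polynomial.Chebyshev.eval_T_real_node (Finset.mem_Iic.mpr hi')]
  have h1 := Polynomial.Chebyshev.zero_lt_prod_node_sub_node hi'
  have h2 : 0 < ∏ j ∈ s.erase i, (a - v j) :=
    Finset.prod_pos fun j _ =>
      sub_pos.mpr (lt_of_le_of_lt (Polynomial.Chebyshev.node_mem_Icc).2 ha)
  change 0 < (-1) ^ i * ∏ j ∈ s.erase i, (v i - v j) at h1
  simp only [l]
  rcases neg_one_pow_eq_or ℝ i with h | h <;> rw [h] at h1 ⊢
  · rw [mul_one, abs_of_pos (div_pos h2 (by linarith))]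
  · rw [abs_of_neg (div_neg_of_pos_of_neg h2 (by linarith))]; ring

/-- The point is cosh(log u), where T_D equals cosh(D log u). -/
theorem eval_T_half_add_inv_le {u : ℝ} (hu : 1 ≤ u) (D : ℕ) :
    (Polynomial.Chebyshev.T ℝ D).eval ((u + u⁻¹) / 2) ≤ u ^ D := by
  have hu0 : 0 < u := by linarith
  rw [← Real.cosh_log hu0, Polynomial.Chebyshev.T_real_cosh]
  have h : Real.exp (D * Real.log u) = u ^ D := by
    rw [mul_comm, Real.exp_mul, Real.exp_log hu0, Real.rpow_natCast]
  have h2 : 0 ≤ (D : ℝ) * Real.log u := mul_nonneg (Nat.cast_nonneg _) (Real.log_nonneg hu)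
  rw [Int.cast_natCast, ← h, Real.cosh_eq]
  have : Real.exp (-(D * Real.log u)) ≤ Real.exp (D * Real.log u) :=
    Real.exp_le_exp.mpr (by linarith)
  linarith

theorem one_sub_sq_mul_eval_U_sq_le_one (n : ℕ) {t : ℝ} (ht : t ∈ Set.Icc (-1 : ℝ) 1) :
    (1 - t ^ 2) * (Polynomial.Chebyshev.U ℝ n).eval t ^ 2 ≤ 1 := by
  have h := Polynomial.Chebyshev.U_real_cos (Real.arccos t) n
  rw [Real.cos_arccos ht.1 ht.2] at h
  have h2 : Real.sin (Real.arccos t) ^ 2 = 1 - t ^ 2 := by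
    rw [Real.sin_sq, Real.cos_arccos ht.1 ht.2]
  calc (1 - t ^ 2) * (Polynomial.Chebyshev.U ℝ n).eval t ^ 2
      = ((Polynomial.Chebyshev.U ℝ n).eval t * Real.sin (Real.arccos t)) ^ 2 := by
        rw [mul_pow, h2]; ring
    _ ≤ 1 := by rw [h]; exact Real.sin_sq_le_one _

/-- A pair of finitely supported laws on `[0, b]`, with weights `wp` and `wm` on common nodes `x`,
whose moments agree up to order `L`: the first one lives on `[1, b]`, the second one has mass at
least `q` at zero, and the common mean lies in `[1, 2]`. -/
structure IsMatchedPair {ι : Type} [Fintype ι] (L : ℕ) (b q : ℝ) (x wp wm : ι → ℝ) : Prop where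
  nonneg : ∀ i, 0 ≤ x i
  le : ∀ i, x i ≤ b
  wp_nonneg : ∀ i, 0 ≤ wp i
  wm_nonneg : ∀ i, 0 ≤ wm i
  wp_sum : ∑ i, wp i = 1
  moments : ∀ k ≤ L, ∑ i, wp i * x i ^ k = ∑ i, wm i * x i ^ k
  one_le : ∀ i, wp i ≠ 0 → 1 ≤ x i
  one_le_mean : 1 ≤ ∑ i, wp i * x i
  mean_le : ∑ i, wp i * x i ≤ 2
  zero_mass : ∃ i₀, x i₀ = 0 ∧ q ≤ wm i₀

/-- The measure u reproduces evaluation at 0, so u⁺ and δ₀ + u⁻ have equal moments up to order L.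
Scaling both by τ⁻¹ makes their mass at most 1 and leaves the atom τ⁻¹ at 0. -/
theorem exists_isMatchedPair_of_signed {κ : Type} [Fintype κ] {L : ℕ} {b τ : ℝ}
    (hτ : 0 < τ) (x u : κ → ℝ) (hx1 : ∀ i, 1 ≤ x i) (hxb : ∀ i, x i ≤ b)
    (hu : ∀ k ≤ L, ∑ i, u i * x i ^ k = 0 ^ k) (hτu : ∑ i, |u i| * x i ≤ τ)
    (i₁ : κ) (hi₁ : x i₁ = 1) :
    ∃ (ι : Type) (_ : Fintype ι) (y wp wm : ι → ℝ), IsMatchedPair L b τ⁻¹ y wp wm := by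
  classical
  have hτi : 0 < τ⁻¹ := inv_pos.mpr hτ
  have hx0 : ∀ i, 0 ≤ x i := fun i => zero_le_one.trans (hx1 i)
  set W := τ⁻¹ * ∑ i, (u i)⁺ with hW
  set M := τ⁻¹ * ∑ i, (u i)⁺ * x i with hM
  have hWM : W ≤ M := by
    rw [hW, hM]
    gcongr with i
    exact le_mul_of_one_le_right (posPart_nonneg _) (hx1 i)
  have hM1 : M ≤ 1 := by
    have h1 : ∑ i, (u i)⁺ * x i ≤ ∑ i, |u i| * x i := by
      gcongr with i
      · exact hx0 i
      · exact sup_le (le_abs_self _) (abs_nonneg _)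
    calc M ≤ τ⁻¹ * τ := by rw [hM]; gcongr; exact h1.trans hτu
      _ = 1 := inv_mul_cancel₀ hτ.ne'
  have hW0 : 0 ≤ W := mul_nonneg hτi.le (Finset.sum_nonneg fun i _ => posPart_nonneg _)
  have hmom : ∀ k ≤ L, ∑ i, (u i)⁺ * x i ^ k = 0 ^ k + ∑ i, (u i)⁻ * x i ^ k := by
    intro k hk
    rw [← hu k hk, ← Finset.sum_add_distrib]
    refine Finset.sum_congr rfl fun i _ => ?_
    conv_rhs => rw [← posPart_sub_negPart (u i)]
    simp only [posPart_sub_negPart]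
    have := posPart_sub_negPart (u i)
    linear_combination (x i ^ k) * this
  -- The missing mass goes to the node 1 in both laws. The mean becomes M + 1 - W, which lies in [1,
  -- 2] because 0 ≤ W ≤ M ≤ 1.
  let z : κ → ℝ := fun i => if i = i₁ then 1 - W else 0
  have hz : ∀ k, ∑ i, z i * x i ^ k = 1 - W := by
    intro k
    simp [z, ite_mul, hi₁]
  have hz0 : ∀ i, 0 ≤ z i := by
    intro i
    simp only [z]
    split_ifs
    · linarith
    · exact le_rfl
  have hwp : ∀ k, ∑ i : Option κ, (Option.elim i 0 fun i => τ⁻¹ * (u i)⁺ + z i) *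
      (Option.elim i 0 x) ^ k = τ⁻¹ * ∑ i, (u i)⁺ * x i ^ k + (1 - W) := by
    intro k
    rw [Fintype.sum_option, ← hz k, Finset.mul_sum, ← Finset.sum_add_distrib]
    simp only [Option.elim_none, zero_mul, zero_add, Option.elim_some]
    exact Finset.sum_congr rfl fun i _ => by ring
  have hwm : ∀ k, ∑ i : Option κ, (Option.elim i τ⁻¹ fun i => τ⁻¹ * (u i)⁻ + z i) *
      (Option.elim i 0 x) ^ k = τ⁻¹ * (0 ^ k + ∑ i, (u i)⁻ * x i ^ k) + (1 - W) := by
    intro k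
    rw [Fintype.sum_option, ← hz k, mul_add, add_assoc, Finset.mul_sum, ← Finset.sum_add_distrib]
    simp only [Option.elim_none, Option.elim_some]
    congr 1
    exact Finset.sum_congr rfl fun i _ => by ring
  have hmean := hwp 1
  simp only [pow_one] at hmean
  refine ⟨Option κ, inferInstance, fun i => Option.elim i 0 x,
    fun i => Option.elim i 0 fun i => τ⁻¹ * (u i)⁺ + z i,
    fun i => Option.elim i τ⁻¹ fun i => τ⁻¹ * (u i)⁻ + z i, ?_, ?_, ?_, ?_, ?_, ?_, ?_, ?_, ?_,
    ⟨none, rfl, le_rfl⟩⟩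
  · rintro (_ | i)
    · exact le_rfl
    · exact hx0 i
  · rintro (_ | i)
    · exact (hx0 i₁).trans (hxb i₁)
    · exact hxb i
  · rintro (_ | i)
    · exact le_rfl
    · exact add_nonneg (mul_nonneg hτi.le (posPart_nonneg _)) (hz0 i)
  · rintro (_ | i)
    · exact hτi.le
    · exact add_nonneg (mul_nonneg hτi.le (negPart_nonneg _)) (hz0 i)
  · have := hwp 0
    simp only [pow_zero, mul_one] at this
    rw [this]
    linarith
  · intro k hk
    rw [hwp, hwm, hmom k hk]
  · rintro (_ | i) h
    · exact absurd rfl h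
    · exact hx1 i
  · rw [hmean]; linarith
  · rw [hmean]; linarith

open Polynomial in
theorem exists_isMatchedPair (L : ℕ) {r : ℝ} (hr : 2 ≤ r) :
    ∃ (ι : Type) (_ : Fintype ι) (x wp wm : ι → ℝ),
      IsMatchedPair L (r ^ 2) (Real.exp (-(4 * L / r + 6))) x wp wm := by
  -- The lower bound on m makes the damping strong enough; the upper bound limits the cost of the
  -- extra degree 2m + 1 to a factor e⁶.
  obtain ⟨m, hm1, hm2⟩ : ∃ m : ℕ, r ≤ 2 * (m + 1) ∧ 2 * ((m : ℝ) + 1) ≤ r + 2 := by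
    refine ⟨⌈r / 2⌉₊ - 1, ?_, ?_⟩ <;>
    · have h0 : 0 < ⌈r / 2⌉₊ := Nat.ceil_pos.mpr (by linarith)
      have h1 : ((⌈r / 2⌉₊ - 1 : ℕ) : ℝ) + 1 = ⌈r / 2⌉₊ := by
        exact_mod_cast Nat.sub_add_cancel h0
      rw [h1]
      have := Nat.le_ceil (r / 2)
      have := Nat.ceil_lt_add_one (show 0 ≤ r / 2 by linarith)
      linarith
  set D := L + (2 * m + 1) with hD
  set a := (r ^ 2 + 1) / (r ^ 2 - 1) with ha
  set w := (r + 1) / (r - 1) with hw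
  have hr1 : 0 < r - 1 := by linarith
  have hr2 : 0 < r ^ 2 - 1 := by nlinarith
  have haw : a = (w + w⁻¹) / 2 := by
    rw [ha, hw, inv_div]
    have : r + 1 ≠ 0 := by linarith
    have : r - 1 ≠ 0 := hr1.ne'
    have h3 : r ^ 2 - 1 = (r - 1) * (r + 1) := by ring
    rw [h3]
    field_simp
    ring
  have ha1 : 1 < a := by rw [ha, lt_div_iff₀ hr2]; linarith
  have hw1 : 1 ≤ w := by rw [hw, le_div_iff₀ hr1]; linarith
  obtain ⟨l, hl, hlT⟩ := exists_chebyshev_extrapolation_weights D ha1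
  set τ := (Polynomial.Chebyshev.T ℝ D).eval a with hτ
  have hτ1 : 1 ≤ τ := Polynomial.Chebyshev.one_le_eval_T_real _ ha1.le
  have hτle : τ ≤ Real.exp (4 * L / r + 6) := by
    have h1 : τ ≤ w ^ D := by rw [hτ, haw]; exact eval_T_half_add_inv_le hw1 D
    have h2 : w ≤ Real.exp (4 / r) := by
      refine le_trans ?_ (Real.add_one_le_exp _)
      rw [hw, div_le_iff₀ hr1]
      have hr0 : 0 < r := by linarith
      rw [← sub_nonneg]
      have : (4 / r + 1) * (r - 1) - (r + 1) = (2 * r - 4) / r := by field_simp; ring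
      rw [this]
      exact div_nonneg (by linarith) hr0.le
    calc τ ≤ w ^ D := h1
      _ ≤ Real.exp (4 / r) ^ D := by gcongr
      _ = Real.exp (4 / r * D) := by rw [Real.exp_mul, Real.rpow_natCast]
      _ ≤ Real.exp (4 * L / r + 6) := by
        gcongr
        have hr0 : 0 < r := by linarith
        have : 4 / r * D = 4 * L / r + 4 * (2 * m + 1) / r := by rw [hD]; push_cast; ring
        rw [this]
        gcongr
        rw [div_le_iff₀ hr0]
        linarith
  -- ξ maps [-1, 1] onto [1, r²] and `a` to 0, so extrapolation to `a` is evaluation at score 0.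
  let ξ : ℝ[X] := C ((r ^ 2 + 1) / 2) - C ((r ^ 2 - 1) / 2) * X
  let t : ℝ[X] := 1 - C (2 / r ^ 2) * ξ
  -- Damping factor: R = 1 at score 0, where t = 1 and U_m(1) = m + 1. On [-1, 1] it is nonnegative,
  -- and since 1 - t = 2ξ/r², Rξ is a multiple of (1 - t²)U_m(t)² ≤ 1. With weights l·R the first
  -- absolute moment is thus at most T_D(a).
  let R : ℝ[X] := C ((2 * ((m : ℝ) + 1) ^ 2)⁻¹) * (1 + t) *
    ((Polynomial.Chebyshev.U ℝ m).comp t) ^ 2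
  have hξ : ∀ y, ξ.eval y = (r ^ 2 + 1) / 2 - (r ^ 2 - 1) / 2 * y := by
    intro y; simp [ξ]
  have hξa : ξ.eval a = 0 := by
    rw [hξ, ha]; field_simp; ring
  have hξdeg : ξ.natDegree ≤ 1 := by
    simp only [ξ]
    compute_degree
  have htdeg : t.natDegree ≤ 1 := by
    simp only [t]
    refine (natDegree_sub_le _ _).trans (max_le (by simp) ?_)
    exact (natDegree_C_mul_le _ _).trans hξdeg
  have ht : ∀ y, t.eval y = 1 - 2 / r ^ 2 * ξ.eval y := by
    intro y; simp [t]
  have hRdeg : R.natDegree ≤ 2 * m + 1 := by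
    simp only [R]
    have h1 : (C ((2 * ((m : ℝ) + 1) ^ 2)⁻¹) * (1 + t)).natDegree ≤ 1 :=
      (natDegree_C_mul_le _ _).trans ((natDegree_add_le _ _).trans (max_le (by simp) htdeg))
    have h2 : (((Polynomial.Chebyshev.U ℝ m).comp t) ^ 2).natDegree ≤ 2 * m := by
      refine natDegree_pow_le.trans ?_
      gcongr
      rw [natDegree_comp]
      calc _ ≤ m * 1 := by
            gcongr
            rw [Polynomial.Chebyshev.natDegree_U_natCast]
        _ = m := mul_one m
    refine natDegree_mul_le.trans (by omega)
  have hR : ∀ y, R.eval y = (2 * ((m : ℝ) + 1) ^ 2)⁻¹ * (1 + t.eval y) *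
      ((Polynomial.Chebyshev.U ℝ m).eval (t.eval y)) ^ 2 := by
    intro y; simp [R]
  have hRa : R.eval a = 1 := by
    rw [hR, ht, hξa]
    simp only [mul_zero, sub_zero, Polynomial.Chebyshev.U_eval_one]
    have : (m : ℝ) + 1 ≠ 0 := by positivity
    push_cast
    field_simp
    ring
  have hξ1 : ∀ y ∈ Set.Icc (-1 : ℝ) 1, 1 ≤ ξ.eval y ∧ ξ.eval y ≤ r ^ 2 := by
    intro y hy
    rw [hξ]
    constructor <;> nlinarith [hy.1, hy.2]
  have hr20 : 0 < r ^ 2 := by positivity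
  have htmem : ∀ y ∈ Set.Icc (-1 : ℝ) 1, t.eval y ∈ Set.Icc (-1 : ℝ) 1 := by
    intro y hy
    obtain ⟨h1, h2⟩ := hξ1 y hy
    rw [ht]
    have h3 : 0 ≤ 2 / r ^ 2 * ξ.eval y := by positivity
    have h4 : 2 / r ^ 2 * ξ.eval y ≤ 2 := by
      rw [div_mul_eq_mul_div, div_le_iff₀ hr20]; linarith
    constructor <;> linarith
  have hR0 : ∀ y ∈ Set.Icc (-1 : ℝ) 1, 0 ≤ R.eval y := by
    intro y hy
    rw [hR]
    have := (htmem y hy).1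
    have : 0 ≤ 1 + t.eval y := by linarith
    positivity
  have hRξ : ∀ y ∈ Set.Icc (-1 : ℝ) 1, R.eval y * ξ.eval y ≤ 1 := by
    intro y hy
    have h1 := one_sub_sq_mul_eval_U_sq_le_one m (htmem y hy)
    have h2 : ξ.eval y = r ^ 2 / 2 * (1 - t.eval y) := by
      rw [ht]; field_simp; ring
    have h3 : R.eval y * ξ.eval y = (2 * ((m : ℝ) + 1) ^ 2)⁻¹ * (r ^ 2 / 2) *
        ((1 - t.eval y ^ 2) * (Polynomial.Chebyshev.U ℝ m).eval (t.eval y) ^ 2) := by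
      rw [hR, h2]; ring
    rw [h3]
    have h4 : (2 * ((m : ℝ) + 1) ^ 2)⁻¹ * (r ^ 2 / 2) ≤ 1 := by
      rw [inv_mul_le_iff₀ (by positivity)]
      have : r ^ 2 ≤ (2 * ((m : ℝ) + 1)) ^ 2 := by gcongr
      linarith
    calc _ ≤ (2 * ((m : ℝ) + 1) ^ 2)⁻¹ * (r ^ 2 / 2) * 1 := by gcongr
      _ ≤ 1 := by rw [mul_one]; exact h4
  have hnode : ∀ i, Polynomial.Chebyshev.node D i ∈ Set.Icc (-1 : ℝ) 1 := fun i =>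
    Polynomial.Chebyshev.node_mem_Icc
  clear_value R t ξ
  obtain ⟨ι, _, y, wp, wm, h⟩ := exists_isMatchedPair_of_signed (κ := Fin (D + 1)) (L := L)
    (b := r ^ 2) (τ := τ) (by linarith)
    (fun i => ξ.eval (Polynomial.Chebyshev.node D i))
    (fun i => l i * R.eval (Polynomial.Chebyshev.node D i))
    (fun i => (hξ1 _ (hnode i)).1) (fun i => (hξ1 _ (hnode i)).2)
    (by
      intro k hk
      have h1 := hl (R * ξ ^ k) (by
        refine natDegree_mul_le.trans ?_
        have : (ξ ^ k).natDegree ≤ k := natDegree_pow_le.trans (by nlinarith)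
        omega)
      rw [eval_mul, eval_pow, hRa, hξa, one_mul] at h1
      rw [h1, Finset.sum_range]
      refine Finset.sum_congr rfl fun i _ => ?_
      rw [eval_mul, eval_pow, mul_assoc])
    (by
      rw [← hlT, Finset.sum_range]
      refine Finset.sum_le_sum fun i _ => ?_
      rw [abs_mul, abs_of_nonneg (hR0 _ (hnode i)), mul_assoc]
      exact mul_le_of_le_one_right (abs_nonneg _) (hRξ _ (hnode i)))
    0 (by
      simp only [Fin.val_zero, Polynomial.Chebyshev.node_eq_one, hξ]; ring)
  refine ⟨ι, inferInstance, y, wp, wm, { h with zero_mass := ?_ }⟩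
  obtain ⟨i₀, h0, h1⟩ := h.zero_mass
  refine ⟨i₀, h0, le_trans ?_ h1⟩
  rw [Real.exp_neg]
  gcongr

/-! ### ℓ¹ distances of extended nonnegative functions and of laws. -/

open ENNReal in
/-- The distance `|a - b|` between extended nonnegative reals. -/
def ennDist (a b : ℝ≥0∞) : ℝ≥0∞ := (a - b) + (b - a)

section ennDist
open ENNReal

theorem ennDist_comm (a b : ℝ≥0∞) : ennDist a b = ennDist b a := add_comm _ _

theorem ennDist_self (a : ℝ≥0∞) : ennDist a a = 0 := by simp [ennDist]

theorem ennDist_triangle (a b c : ℝ≥0∞) : ennDist a c ≤ ennDist a b + ennDist b c := by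
  have h1 : a - c ≤ (a - b) + (b - c) := tsub_le_tsub_add_tsub
  have h2 : c - a ≤ (c - b) + (b - a) := tsub_le_tsub_add_tsub
  calc ennDist a c ≤ ((a - b) + (b - c)) + ((c - b) + (b - a)) := add_le_add h1 h2
    _ = ennDist a b + ennDist b c := by unfold ennDist; ring

theorem ennDist_le_add (a b : ℝ≥0∞) : ennDist a b ≤ a + b :=
  add_le_add tsub_le_self tsub_le_self

theorem ennDist_mul_left_le (c a b : ℝ≥0∞) : ennDist (c * a) (c * b) ≤ c * ennDist a b := by
  have h : ∀ a b : ℝ≥0∞, c * a - c * b ≤ c * (a - b) := fun a b => by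
    rw [tsub_le_iff_right, ← mul_add]
    gcongr
    exact le_tsub_add
  unfold ennDist
  rw [mul_add]
  exact add_le_add (h a b) (h b a)

theorem ennDist_mul_right_le (c a b : ℝ≥0∞) : ennDist (a * c) (b * c) ≤ ennDist a b * c := by
  rw [mul_comm a, mul_comm b, mul_comm _ c]
  exact ennDist_mul_left_le c a b

theorem ennDist_tsum_le {α : Type*} (f g : α → ℝ≥0∞) :
    ennDist (∑' x, f x) (∑' x, g x) ≤ ∑' x, ennDist (f x) (g x) := by
  have h : ∀ f g : α → ℝ≥0∞, ∑' x, f x - ∑' x, g x ≤ ∑' x, (f x - g x) := fun f g => by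
    rw [tsub_le_iff_right, ← ENNReal.tsum_add]
    exact ENNReal.tsum_le_tsum fun x => le_tsub_add
  unfold ennDist
  rw [ENNReal.tsum_add]
  exact add_le_add (h f g) (h g f)

theorem ennDist_ofReal {a b : ℝ} (ha : 0 ≤ a) (hb : 0 ≤ b) :
    ennDist (ENNReal.ofReal a) (ENNReal.ofReal b) = ENNReal.ofReal |a - b| := by
  unfold ennDist
  rw [← ENNReal.ofReal_sub _ hb, ← ENNReal.ofReal_sub _ ha]
  rcases le_total a b with h | h
  · rw [ENNReal.ofReal_of_nonpos (sub_nonpos.mpr h), zero_add, abs_sub_comm,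
      abs_of_nonneg (sub_nonneg.mpr h)]
  · rw [ENNReal.ofReal_of_nonpos (sub_nonpos.mpr h), add_zero, abs_of_nonneg (sub_nonneg.mpr h)]

theorem tsum_fin_succ_arrow {α : Type*} {n : ℕ} (F : (Fin (n + 1) → α) → ℝ≥0∞) :
    ∑' h, F h = ∑' a : α, ∑' h : Fin n → α, F (Fin.cons a h) := by
  rw [← (Fin.consEquiv fun _ : Fin (n + 1) => α).tsum_eq F, ENNReal.tsum_prod']
  rfl

theorem tsum_prod_fin_arrow {α : Type*} (n : ℕ) (f : α → ℝ≥0∞) :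
    ∑' h : Fin n → α, ∏ i, f (h i) = (∑' a, f a) ^ n := by
  induction n with
  | zero => simp
  | succ n ih =>
    rw [tsum_fin_succ_arrow]
    simp only [Fin.prod_univ_succ, Fin.cons_zero, Fin.cons_succ, ENNReal.tsum_mul_left, ih,
      ENNReal.tsum_mul_right]
    rw [pow_succ']

/-- Hybrid argument: replace one coordinate at a time. -/
theorem tsum_ennDist_prod_le {α : Type*} (n : ℕ) {f g : α → ℝ≥0∞} (hf : ∑' a, f a = 1)
    (hg : ∑' a, g a = 1) :
    ∑' h : Fin n → α, ennDist (∏ i, f (h i)) (∏ i, g (h i)) ≤ n * ∑' a, ennDist (f a) (g a) := by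
  induction n with
  | zero => simp [ennDist_self]
  | succ n ih =>
    rw [tsum_fin_succ_arrow]
    simp only [Fin.prod_univ_succ, Fin.cons_zero, Fin.cons_succ]
    calc ∑' a, ∑' h : Fin n → α, ennDist (f a * ∏ i, f (h i)) (g a * ∏ i, g (h i))
        ≤ ∑' a, ∑' h : Fin n → α, (f a * ennDist (∏ i, f (h i)) (∏ i, g (h i)) +
            ennDist (f a) (g a) * ∏ i, g (h i)) := by
          gcongr with a h
          exact (ennDist_triangle _ (f a * ∏ i, g (h i)) _).trans
            (add_le_add (ennDist_mul_left_le _ _ _) (ennDist_mul_right_le _ _ _))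
      _ = ∑' h : Fin n → α, ennDist (∏ i, f (h i)) (∏ i, g (h i)) +
            ∑' a, ennDist (f a) (g a) := by
          simp only [ENNReal.tsum_add, ENNReal.tsum_mul_left, ENNReal.tsum_mul_right, hf, one_mul,
            tsum_prod_fin_arrow, hg, one_pow, mul_one]
      _ ≤ n * ∑' a, ennDist (f a) (g a) + ∑' a, ennDist (f a) (g a) := by gcongr
      _ = (n + 1 : ℕ) * ∑' a, ennDist (f a) (g a) := by push_cast; ring

end ennDist

section tvDist
open ENNReal

theorem tvDist_le_of_tsum_ennDist_le {α : Type*} (P Q : PMF α) {δ : ℝ} (hδ : 0 ≤ δ)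
    (h : ∑' x, ennDist (P x) (Q x) ≤ ENNReal.ofReal (2 * δ)) : tvDist P Q ≤ δ := by
  have h1 : ∀ x, ennDist (P x) (Q x) = ENNReal.ofReal |(P x).toReal - (Q x).toReal| := by
    intro x
    rw [← ennDist_ofReal toReal_nonneg toReal_nonneg, ENNReal.ofReal_toReal (P.apply_ne_top x),
      ENNReal.ofReal_toReal (Q.apply_ne_top x)]
  have h2 : ∑' x, |(P x).toReal - (Q x).toReal| = (∑' x, ennDist (P x) (Q x)).toReal := by
    rw [ENNReal.tsum_toReal_eq]
    · exact tsum_congr fun x => by rw [h1, ENNReal.toReal_ofReal (abs_nonneg _)]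
    · intro x; rw [h1]; exact ofReal_ne_top
  unfold tvDist
  rw [h2]
  have := ENNReal.toReal_mono ofReal_ne_top h
  rw [ENNReal.toReal_ofReal (by positivity)] at this
  linarith

theorem tsum_ennDist_triangle {α : Type*} (f g h : α → ℝ≥0∞) :
    ∑' x, ennDist (f x) (h x) ≤ ∑' x, ennDist (f x) (g x) + ∑' x, ennDist (g x) (h x) := by
  rw [← ENNReal.tsum_add]
  exact ENNReal.tsum_le_tsum fun x => ennDist_triangle _ _ _

theorem tsum_ennDist_bind_le {α γ : Type*} (D : PMF α) (f g : α → PMF γ) (s : Set α)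
    (hs : ∀ x ∉ s, f x = g x) :
    ∑' y, ennDist (D.bind f y) (D.bind g y) ≤ 2 * ∑' x, s.indicator D x := by
  classical
  simp only [PMF.bind_apply]
  calc ∑' y, ennDist (∑' x, D x * f x y) (∑' x, D x * g x y)
      ≤ ∑' y, ∑' x, D x * ennDist (f x y) (g x y) := by
        gcongr with y
        exact (ennDist_tsum_le _ _).trans
          (ENNReal.tsum_le_tsum fun x => ennDist_mul_left_le _ _ _)
    _ = ∑' x, D x * ∑' y, ennDist (f x y) (g x y) := by
        rw [ENNReal.tsum_comm]
        simp only [ENNReal.tsum_mul_left]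
    _ ≤ ∑' x, 2 * s.indicator D x := by
        refine ENNReal.tsum_le_tsum fun x => ?_
        by_cases hx : x ∈ s
        · rw [Set.indicator_of_mem hx, mul_comm 2]
          gcongr
          calc ∑' y, ennDist (f x y) (g x y) ≤ ∑' y, (f x y + g x y) := by
                gcongr; exact ennDist_le_add _ _
            _ = 2 := by rw [ENNReal.tsum_add, PMF.tsum_coe, PMF.tsum_coe]; norm_num
        · simp [hs x hx, ennDist_self]
    _ = 2 * ∑' x, s.indicator D x := ENNReal.tsum_mul_left

end tvDist

/-! ### Poisson mixtures with matched moments. -/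

section Poisson
open Nat

/-- The Poisson probability of `j` at rate `y`. -/
noncomputable def poissonWeight (y : ℝ) (j : ℕ) : ℝ := Real.exp (-y) * y ^ j / j !

theorem poissonWeight_nonneg {y : ℝ} (hy : 0 ≤ y) (j : ℕ) : 0 ≤ poissonWeight y j := by
  unfold poissonWeight; positivity

theorem hasSum_pow_div_factorial (y : ℝ) : HasSum (fun j : ℕ => y ^ j / j !) (Real.exp y) := by
  rw [Real.exp_eq_exp_ℝ]
  exact NormedSpace.expSeries_div_hasSum_exp y

theorem tsum_ofReal_pow_div_factorial {y : ℝ} (hy : 0 ≤ y) :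
    ∑' j : ℕ, ENNReal.ofReal (y ^ j / j !) = ENNReal.ofReal (Real.exp y) := by
  have h := hasSum_pow_div_factorial y
  rw [← ENNReal.ofReal_tsum_of_nonneg (fun j => by positivity) h.summable, h.tsum_eq]

theorem tsum_ofReal_poissonWeight {y : ℝ} (hy : 0 ≤ y) :
    ∑' j, ENNReal.ofReal (poissonWeight y j) = 1 := by
  unfold poissonWeight
  simp only [mul_div_assoc, ENNReal.ofReal_mul (Real.exp_nonneg (-y))]
  rw [ENNReal.tsum_mul_left, tsum_ofReal_pow_div_factorial hy,
    ← ENNReal.ofReal_mul (Real.exp_nonneg _), ← Real.exp_add]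
  simp

theorem tsum_ofReal_poissonWeight_add_le {y : ℝ} (hy : 0 ≤ y) (N : ℕ) :
    ∑' j, ENNReal.ofReal (poissonWeight y (j + N)) ≤ ENNReal.ofReal (y ^ N / N !) := by
  calc ∑' j, ENNReal.ofReal (poissonWeight y (j + N))
      ≤ ∑' j, ENNReal.ofReal (y ^ N / N !) * ENNReal.ofReal (poissonWeight y j) := by
        gcongr with j
        rw [← ENNReal.ofReal_mul (by positivity)]
        apply ENNReal.ofReal_le_ofReal
        unfold poissonWeight
        have h1 : ((N ! * j ! : ℕ) : ℝ) ≤ ((j + N)! : ℕ) := by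
          rw [add_comm j]
          exact_mod_cast Nat.le_of_dvd (Nat.factorial_pos _)
            (Nat.factorial_mul_factorial_dvd_factorial_add N j)
        calc Real.exp (-y) * y ^ (j + N) / (j + N)!
            ≤ Real.exp (-y) * y ^ (j + N) / ((N ! * j ! : ℕ) : ℝ) := by
              gcongr
          _ = y ^ N / N ! * (Real.exp (-y) * y ^ j / j !) := by
              push_cast
              field_simp
              ring
    _ = ENNReal.ofReal (y ^ N / N !) := by
        rw [ENNReal.tsum_mul_left, tsum_ofReal_poissonWeight hy, mul_one]

/-- Induction on m: the signed remainder of order m + 1 vanishes at 0 and its derivative is the one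
of order m. -/
theorem neg_one_pow_mul_exp_neg_sub_sum_nonneg (m : ℕ) {y : ℝ} (hy : 0 ≤ y) :
    0 ≤ (-1) ^ m * (Real.exp (-y) - ∑ k ∈ Finset.range m, (-y) ^ k / k !) := by
  induction m generalizing y with
  | zero => simpa using Real.exp_nonneg _
  | succ m ih =>
    set g : ℝ → ℝ := fun y =>
      (-1) ^ (m + 1) * (Real.exp (-y) - ∑ k ∈ Finset.range (m + 1), (-y) ^ k / k !)
    have hd : ∀ y, HasDerivAt g
        ((-1) ^ m * (Real.exp (-y) - ∑ k ∈ Finset.range m, (-y) ^ k / k !)) y := by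
      intro y
      have h1 : HasDerivAt (fun y : ℝ => Real.exp (-y)) (Real.exp (-y) * -1) y :=
        (hasDerivAt_neg y).exp
      have h2 : HasDerivAt (fun y : ℝ => ∑ k ∈ Finset.range m, (-y) ^ (k + 1) / (k + 1)! + 1)
          (∑ k ∈ Finset.range m, -((-y) ^ k / k !)) y := by
        refine HasDerivAt.add_const _ (HasDerivAt.fun_sum fun k _ => ?_)
        have h3 := ((hasDerivAt_neg y).fun_pow (k + 1)).div_const (((k + 1)! : ℕ) : ℝ)
        refine h3.congr_deriv ?_
        rw [Nat.factorial_succ]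
        push_cast
        have : (k : ℝ) + 1 ≠ 0 := by positivity
        field_simp
      have h4 := (h1.fun_sub h2).const_mul ((-1 : ℝ) ^ (m + 1))
      have hg : g = fun y => (-1) ^ (m + 1) * (Real.exp (-y) -
          (∑ k ∈ Finset.range m, (-y) ^ (k + 1) / (k + 1)! + 1)) := by
        funext z
        simp only [g]
        rw [Finset.sum_range_succ']
        simp
      rw [hg]
      refine h4.congr_deriv ?_
      rw [Finset.sum_neg_distrib]
      ring
    have hmono : MonotoneOn g (Set.Ici 0) := by
      refine monotoneOn_of_deriv_nonneg (convex_Ici 0)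
        (fun z _ => (hd z).continuousAt.continuousWithinAt)
        (fun z _ => (hd z).differentiableAt.differentiableWithinAt) ?_
      intro z hz
      rw [interior_Ici] at hz
      rw [(hd z).deriv]
      exact ih (le_of_lt hz)
    have h0 : g 0 = 0 := by
      simp only [g]
      rw [Finset.sum_range_succ']
      simp
    have := hmono (Set.self_mem_Ici) (Set.mem_Ici.mpr hy) hy
    rwa [h0] at this

theorem abs_exp_neg_sub_sum_le (m : ℕ) {y : ℝ} (hy : 0 ≤ y) :
    |Real.exp (-y) - ∑ k ∈ Finset.range m, (-y) ^ k / k !| ≤ y ^ m / m ! := by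
  have h1 := neg_one_pow_mul_exp_neg_sub_sum_nonneg m hy
  have h2 := neg_one_pow_mul_exp_neg_sub_sum_nonneg (m + 1) hy
  rw [Finset.sum_range_succ, neg_pow y m] at h2
  have h3 : (-1 : ℝ) ^ m * (-1) ^ m = 1 := by rw [← mul_pow]; simp
  rw [← one_mul |_|, ← abs_neg_one_pow (α := ℝ) m, ← abs_mul, abs_of_nonneg h1]
  rw [pow_succ] at h2
  have : (-1 : ℝ) ^ m * -1 * (Real.exp (-y) -
      (∑ x ∈ Finset.range m, (-y) ^ x / x ! + (-1) ^ m * y ^ m / m !)) =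
      ((-1) ^ m * (-1) ^ m) * (y ^ m / m !) -
        (-1) ^ m * (Real.exp (-y) - ∑ k ∈ Finset.range m, (-y) ^ k / k !) := by ring
  rw [this, h3] at h2
  linarith

/-- For j < N, vanishing moments remove the Taylor polynomial of e^(-y), and only its remainder
counts. For j ≥ N the Poisson tail is already of size y^N/N!. -/
theorem tsum_abs_sum_mul_poissonWeight_le {ι : Type*} [Fintype ι] {N : ℕ}
    {Λ c : ℝ} (u y : ι → ℝ) (hy0 : ∀ i, 0 ≤ y i) (hyΛ : ∀ i, y i ≤ Λ)
    (hc : ∑ i, |u i| ≤ c) (hu : ∀ k < N, ∑ i, u i * y i ^ k = 0) :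
    ∑' j, ENNReal.ofReal |∑ i, u i * poissonWeight (y i) j| ≤
      ENNReal.ofReal (c * (3 * Λ) ^ N / N !) := by
  have hc0 : 0 ≤ c := (Finset.sum_nonneg fun i _ => abs_nonneg _).trans hc
  by_cases hne : Nonempty ι
  swap
  · rw [not_nonempty_iff] at hne
    simp
  have hΛ : 0 ≤ Λ := (hy0 hne.some).trans (hyΛ _)
  have key : ∀ r : ℕ, ∑ i, |u i| * y i ^ r ≤ c * Λ ^ r := by
    intro r
    calc ∑ i, |u i| * y i ^ r ≤ ∑ i, |u i| * Λ ^ r := by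
          gcongr with i
          · exact hy0 i
          · exact hyΛ i
      _ = (∑ i, |u i|) * Λ ^ r := by rw [Finset.sum_mul]
      _ ≤ c * Λ ^ r := by gcongr
  have head : ∀ j ∈ Finset.range N, |∑ i, u i * poissonWeight (y i) j| ≤
      c * Λ ^ N / N ! * (N.choose j) := by
    intro j hj
    have hj' : j < N := Finset.mem_range.mp hj
    -- Cutting the series at N - j keeps all the removed powers y^(j+k) below N.
    have e1 : ∑ i, u i * poissonWeight (y i) j = ∑ i, u i * (y i ^ j / j ! *
        (Real.exp (-y i) - ∑ k ∈ Finset.range (N - j), (-y i) ^ k / k !)) := by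
      have e2 : ∑ i, u i * (y i ^ j / j ! *
          ∑ k ∈ Finset.range (N - j), (-y i) ^ k / k !) = 0 := by
        simp only [Finset.mul_sum]
        rw [Finset.sum_comm]
        refine Finset.sum_eq_zero fun k hk => ?_
        have := hu (j + k) (by have := Finset.mem_range.mp hk; omega)
        calc _ = ((-1) ^ k / (j ! * k !)) * ∑ i, u i * y i ^ (j + k) := by
              rw [Finset.mul_sum]
              refine Finset.sum_congr rfl fun i _ => ?_
              rw [neg_pow (y i), pow_add]
              field_simp
          _ = 0 := by rw [this, mul_zero]
      rw [← sub_zero (∑ i, u i * poissonWeight (y i) j), ← e2, ← Finset.sum_sub_distrib]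
      refine Finset.sum_congr rfl fun i _ => ?_
      unfold poissonWeight
      ring
    rw [e1]
    calc _ ≤ ∑ i, |u i * (y i ^ j / j ! *
            (Real.exp (-y i) - ∑ k ∈ Finset.range (N - j), (-y i) ^ k / k !))| :=
          Finset.abs_sum_le_sum_abs _ _
      _ ≤ ∑ i, |u i| * (y i ^ j / j ! * (y i ^ (N - j) / (N - j)!)) := by
          refine Finset.sum_le_sum fun i _ => ?_
          have hyi := hy0 i
          rw [abs_mul, abs_mul, abs_of_nonneg (by positivity : 0 ≤ y i ^ j / (j ! : ℝ))]
          gcongr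
          exact abs_exp_neg_sub_sum_le _ (hy0 i)
      _ = (∑ i, |u i| * y i ^ N) * ((j ! * (N - j)! : ℝ)⁻¹) := by
          rw [Finset.sum_mul]
          refine Finset.sum_congr rfl fun i _ => ?_
          have : y i ^ N = y i ^ j * y i ^ (N - j) := by rw [← pow_add]; congr 1; omega
          rw [this]
          field_simp
      _ ≤ (c * Λ ^ N) * ((j ! * (N - j)! : ℝ)⁻¹) := by
          gcongr
          exact key N
      _ = c * Λ ^ N / N ! * (N.choose j) := by
          rw [Nat.cast_choose ℝ hj'.le]
          field_simp
  have tail : ∑' j, ENNReal.ofReal |∑ i, u i * poissonWeight (y i) (j + N)| ≤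
      ENNReal.ofReal (c * Λ ^ N / N !) := by
    calc ∑' j, ENNReal.ofReal |∑ i, u i * poissonWeight (y i) (j + N)|
        ≤ ∑' j, ∑ i, ENNReal.ofReal |u i| * ENNReal.ofReal (poissonWeight (y i) (j + N)) := by
          gcongr with j
          have hw := fun i => poissonWeight_nonneg (hy0 i) (j + N)
          calc _ ≤ ENNReal.ofReal (∑ i, |u i| * poissonWeight (y i) (j + N)) := by
                apply ENNReal.ofReal_le_ofReal
                refine (Finset.abs_sum_le_sum_abs _ _).trans (le_of_eq ?_)
                exact Finset.sum_congr rfl fun i _ => by rw [abs_mul, abs_of_nonneg (hw i)]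
            _ = _ := by
                rw [ENNReal.ofReal_sum_of_nonneg fun i _ => mul_nonneg (abs_nonneg _) (hw i)]
                exact Finset.sum_congr rfl fun i _ => ENNReal.ofReal_mul (abs_nonneg _)
      _ = ∑ i, ENNReal.ofReal |u i| * ∑' j, ENNReal.ofReal (poissonWeight (y i) (j + N)) := by
          rw [Summable.tsum_finsetSum fun i _ => ENNReal.summable]
          simp only [ENNReal.tsum_mul_left]
      _ ≤ ∑ i, ENNReal.ofReal |u i| * ENNReal.ofReal (y i ^ N / N !) := by
          gcongr with i
          exact tsum_ofReal_poissonWeight_add_le (hy0 i) N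
      _ = ENNReal.ofReal (∑ i, |u i| * (y i ^ N / N !)) := by
          have hw : ∀ i, 0 ≤ y i ^ N / (N ! : ℝ) := fun i => by
            have := hy0 i
            positivity
          rw [ENNReal.ofReal_sum_of_nonneg fun i _ => mul_nonneg (abs_nonneg _) (hw i)]
          exact Finset.sum_congr rfl fun i _ => (ENNReal.ofReal_mul (abs_nonneg _)).symm
      _ ≤ ENNReal.ofReal (c * Λ ^ N / N !) := by
          apply ENNReal.ofReal_le_ofReal
          simp only [← mul_div_assoc]
          rw [← Finset.sum_div]
          gcongr
          exact key N
  rw [← ENNReal.summable.sum_add_tsum_nat_add' (k := N)]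
  have hz : 0 ≤ c * Λ ^ N / (N ! : ℝ) := by positivity
  calc _ ≤ ∑ j ∈ Finset.range N, ENNReal.ofReal (c * Λ ^ N / N ! * (N.choose j)) +
        ENNReal.ofReal (c * Λ ^ N / N !) := by
        gcongr with j hj
        exact head j hj
    -- The tail supplies the missing binomial coefficient at j = N.
    _ = ENNReal.ofReal (c * Λ ^ N / N ! * 2 ^ N) := by
        rw [← ENNReal.ofReal_sum_of_nonneg fun j _ => by positivity,
          ← ENNReal.ofReal_add (Finset.sum_nonneg fun j _ => by positivity) hz,
          ← Finset.mul_sum]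
        congr 1
        have := Nat.sum_range_choose N
        rw [Finset.sum_range_succ, Nat.choose_self] at this
        have h2 : (2 : ℝ) ^ N = ∑ j ∈ Finset.range N, (N.choose j : ℝ) + 1 := by
          exact_mod_cast this.symm
        rw [h2]; ring
    _ ≤ ENNReal.ofReal (c * (3 * Λ) ^ N / N !) := by
        apply ENNReal.ofReal_le_ofReal
        rw [mul_pow]
        calc c * Λ ^ N / N ! * 2 ^ N ≤ c * Λ ^ N / N ! * 3 ^ N := by gcongr; norm_num
          _ = _ := by ring

end Poisson

/-! ### Multinomial formula, Poisson sample size, exponential Markov bounds. -/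

section Histogram
open ENNReal Nat

theorem iidSamples_apply {α : Type*} (p : PMF α) (m : ℕ) (x : Fin m → α) :
    iidSamples p m x = ∏ i, p (x i) := by
  classical
  induction m with
  | zero =>
    simp only [iidSamples, Finset.univ_eq_empty, Finset.prod_empty]
    rw [Subsingleton.elim x Fin.elim0, PMF.pure_apply_self]
  | succ m ih =>
    simp only [iidSamples, PMF.bind_apply, PMF.map_apply]
    rw [Fin.prod_univ_succ, tsum_eq_single (x 0), tsum_eq_single (Fin.tail x)]
    · rw [if_pos (Fin.cons_self_tail x).symm, ih]
      rfl
    · intro y hy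
      rw [if_neg]
      intro e
      apply hy
      rw [e, Fin.tail_cons]
    · intro a ha
      rw [ENNReal.tsum_eq_zero.mpr, mul_zero]
      intro y
      rw [if_neg]
      intro h
      apply ha
      rw [h, Fin.cons_zero]

theorem histogram_cons {n m : ℕ} (a : Fin n) (x : Fin m → Fin n) :
    histogram (Fin.cons a x : Fin (m + 1) → Fin n) = histogram x + Pi.single a 1 := by
  funext i
  simp only [histogram, Pi.add_apply, Finset.card_filter]
  rw [Fin.sum_univ_succ]
  simp only [Fin.cons_zero, Fin.cons_succ]
  rw [add_comm]
  congr 1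
  rw [Pi.single_apply]
  simp [eq_comm]

theorem histogramOf_zero {n : ℕ} (p : PMF (Fin n)) : histogramOf p 0 = PMF.pure 0 := by
  rw [histogramOf, iidSamples, PMF.pure_map]
  congr 1

theorem histogramOf_succ {n : ℕ} (p : PMF (Fin n)) (m : ℕ) :
    histogramOf p (m + 1) =
      p.bind fun a => (histogramOf p m).map fun h => h + Pi.single a 1 := by
  rw [histogramOf, iidSamples, PMF.map_bind]
  congr 1
  funext a
  rw [histogramOf, PMF.map_comp, PMF.map_comp]
  congr 1
  funext x
  exact histogram_cons a x

/-- The multinomial formula, with the factorials on the left to avoid division in `ℝ≥0∞`; the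
induction conditions on the first sample. -/
theorem prod_factorial_mul_histogramOf_apply {n : ℕ} (p : PMF (Fin n)) (m : ℕ) (h : Fin n → ℕ) :
    (∏ i, ((h i)! : ℝ≥0∞)) * histogramOf p m h =
      if ∑ i, h i = m then (m ! : ℝ≥0∞) * ∏ i, p i ^ h i else 0 := by
  classical
  induction m generalizing h with
  | zero =>
    rw [histogramOf_zero, PMF.pure_apply]
    by_cases hh : h = 0
    · subst hh; simp
    · have : ∑ i, h i ≠ 0 := by
        intro h0
        apply hh
        funext i
        simpa using (Finset.sum_eq_zero_iff.mp h0) i (Finset.mem_univ i)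
      rw [if_neg hh, if_neg this, mul_zero]
  | succ m ih =>
    rw [histogramOf_succ, PMF.bind_apply, tsum_fintype, Finset.mul_sum]
    have key : ∀ a : Fin n, (∏ i, ((h i)! : ℝ≥0∞)) *
        (p a * (PMF.map (fun h => h + Pi.single a 1) (histogramOf p m)) h) =
        if ∑ i, h i = m + 1 then (h a : ℝ≥0∞) * (m ! * ∏ i, p i ^ h i) else 0 := by
      intro a
      rw [PMF.map_apply]
      rcases Nat.eq_zero_or_pos (h a) with h0 | h0
      · rw [ENNReal.tsum_eq_zero.mpr]
        · simp [h0]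
        · intro h'
          rw [if_neg]
          intro e
          have := congrFun e a
          simp [h0] at this
      · set g : Fin n → ℕ := Function.update h a (h a - 1) with hg
        have hgh : h = g + Pi.single a 1 := by
          funext i
          by_cases hi : i = a
          · subst hi; simp [hg]; omega
          · simp [hg, hi]
        rw [tsum_eq_single g]
        swap
        · intro h' hh'
          rw [if_neg]
          intro e
          apply hh'
          exact add_right_cancel (e.symm.trans hgh)
        rw [if_pos hgh]
        have hga : g a = h a - 1 := by simp [hg]
        have hgi : ∀ i ∈ Finset.univ.erase a, g i = h i := fun i hi => by
          simp [hg, Finset.ne_of_mem_erase hi]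
        have e1 : (∏ i, ((h i)! : ℝ≥0∞)) = h a * ∏ i, ((g i)! : ℝ≥0∞) := by
          rw [← Finset.mul_prod_erase _ _ (Finset.mem_univ a),
            ← Finset.mul_prod_erase _ (fun i => ((g i)! : ℝ≥0∞)) (Finset.mem_univ a),
            Finset.prod_congr rfl fun i hi => by rw [← hgi i hi], hga, ← mul_assoc,
            ← Nat.mul_factorial_pred h0.ne']
          push_cast
          rfl
        have e2 : p a * ∏ i, p i ^ g i = ∏ i, p i ^ h i := by
          rw [← Finset.mul_prod_erase _ (fun i => p i ^ h i) (Finset.mem_univ a),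
            ← Finset.mul_prod_erase _ (fun i => p i ^ g i) (Finset.mem_univ a), ← mul_assoc,
            hga, ← _root_.pow_succ', Nat.sub_add_cancel h0]
          congr 1
          exact Finset.prod_congr rfl fun i hi => by rw [hgi i hi]
        have e3 : ∑ i, h i = ∑ i, g i + 1 := by
          conv_lhs => rw [hgh]
          simp [Finset.sum_add_distrib]
        calc (∏ i, ((h i)! : ℝ≥0∞)) * (p a * histogramOf p m g)
            = h a * p a * ((∏ i, ((g i)! : ℝ≥0∞)) * histogramOf p m g) := by rw [e1]; ring
          _ = _ := by
            rw [ih, e3]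
            simp only [Nat.add_right_cancel_iff]
            split_ifs
            · rw [← e2]; ring
            · rw [mul_zero]
    rw [Finset.sum_congr rfl fun a _ => key a]
    split_ifs with hs
    · rw [← Finset.sum_mul, ← Nat.cast_sum, hs, Nat.factorial_succ]
      push_cast
      ring
    · simp

/-- Only m = ∑ h i contributes; its Poisson weight cancels the multinomial m!, and ∑ p i = 1 splits
e^(-S). -/
theorem tsum_poissonWeight_mul_histogramOf {n : ℕ} (p : PMF (Fin n)) {S : ℝ} (hS : 0 ≤ S)
    (h : Fin n → ℕ) :
    ∑' m, ENNReal.ofReal (poissonWeight S m) * histogramOf p m h =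
      ∏ i, ENNReal.ofReal (poissonWeight (S * (p i).toReal) (h i)) := by
  have hfac : (∏ i, ((h i)! : ℝ≥0∞)) ≠ 0 :=
    Finset.prod_ne_zero_iff.mpr fun i _ => by exact_mod_cast Nat.factorial_ne_zero _
  have hfac' : (∏ i, ((h i)! : ℝ≥0∞)) ≠ ∞ := ENNReal.prod_ne_top fun i _ => ENNReal.natCast_ne_top _
  have hm : ∀ m, m ≠ ∑ i, h i → histogramOf p m h = 0 := by
    intro m hne
    have := prod_factorial_mul_histogramOf_apply p m h
    rw [if_neg hne.symm, _root_.mul_eq_zero] at this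
    exact this.resolve_left hfac
  rw [tsum_eq_single (∑ i, h i) fun m hne => by rw [hm m hne, mul_zero]]
  rw [← ENNReal.mul_right_inj hfac hfac']
  have h1 := prod_factorial_mul_histogramOf_apply p (∑ i, h i) h
  rw [if_pos rfl] at h1
  rw [mul_left_comm, h1, ← Finset.prod_mul_distrib]
  have h2 : ∀ i, ((h i)! : ℝ≥0∞) * ENNReal.ofReal (poissonWeight (S * (p i).toReal) (h i)) =
      ENNReal.ofReal (Real.exp (-(S * (p i).toReal)) * (S * (p i).toReal) ^ h i) := by
    intro i
    rw [← ENNReal.ofReal_natCast, ← ENNReal.ofReal_mul (by positivity)]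
    unfold poissonWeight
    congr 1
    field_simp
  have hp : ∀ i, p i = ENNReal.ofReal (p i).toReal := fun i =>
    (ENNReal.ofReal_toReal (p.apply_ne_top i)).symm
  have hsum : ∑ i, (p i).toReal = 1 := by
    have := p.tsum_coe
    rw [tsum_fintype] at this
    rw [← ENNReal.toReal_sum fun i _ => p.apply_ne_top i, this, ENNReal.toReal_one]
  simp only [h2]
  rw [← ENNReal.ofReal_prod_of_nonneg fun i _ => by positivity, Finset.prod_mul_distrib,
    ← Real.exp_sum, Finset.sum_neg_distrib, ← Finset.mul_sum, hsum, mul_one]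
  simp only [mul_pow]
  rw [Finset.prod_mul_distrib, Finset.prod_pow_eq_pow_sum]
  have h3 : ∏ i, p i ^ h i = ENNReal.ofReal (∏ i, (p i).toReal ^ h i) := by
    rw [ENNReal.ofReal_prod_of_nonneg fun i _ => by positivity]
    exact Finset.prod_congr rfl fun i _ => by
      rw [ENNReal.ofReal_pow toReal_nonneg, ← hp]
  rw [h3, ← ENNReal.ofReal_natCast, ← ENNReal.ofReal_mul (by positivity),
    ← ENNReal.ofReal_mul (poissonWeight_nonneg hS _)]
  unfold poissonWeight
  congr 1
  field_simp

/-- The Poisson distribution with rate `y`. -/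
noncomputable def poissonLaw (y : ℝ) (hy : 0 ≤ y) : PMF ℕ :=
  ⟨fun j => ENNReal.ofReal (poissonWeight y j), by
    rw [← tsum_ofReal_poissonWeight hy]; exact ENNReal.summable.hasSum⟩

theorem poissonLaw_apply (y : ℝ) (hy : 0 ≤ y) (j : ℕ) :
    poissonLaw y hy j = ENNReal.ofReal (poissonWeight y j) := rfl

/-- Chernoff bound: for m < s insert e^s ≥ 2^m and sum the exponential series at y/2. -/
theorem tsum_poissonLaw_lt_le {y : ℝ} (hy : 0 ≤ y) {s : ℝ} (hs : s ≤ y / 4) :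
    ∑' m, {m : ℕ | (m : ℝ) < s}.indicator (poissonLaw y hy) m ≤
      ENNReal.ofReal (Real.exp (-(y / 4))) := by
  calc ∑' m, {m : ℕ | (m : ℝ) < s}.indicator (poissonLaw y hy) m
      ≤ ∑' m : ℕ, ENNReal.ofReal (Real.exp (s - y)) * ENNReal.ofReal ((y / 2) ^ m / m !) := by
        refine ENNReal.tsum_le_tsum fun m => ?_
        by_cases hm : (m : ℝ) < s
        · rw [Set.indicator_of_mem (show m ∈ {m : ℕ | (m : ℝ) < s} from hm), poissonLaw_apply,
            ← ENNReal.ofReal_mul (Real.exp_nonneg _)]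
          apply ENNReal.ofReal_le_ofReal
          unfold poissonWeight
          have h1 : (2 : ℝ) ^ m ≤ Real.exp s := by
            calc (2 : ℝ) ^ m ≤ Real.exp 1 ^ m := by
                  gcongr
                  have := Real.add_one_le_exp 1
                  linarith
              _ = Real.exp m := by rw [← Real.exp_nat_mul, mul_one]
              _ ≤ Real.exp s := by gcongr
          have h2 : Real.exp (s - y) = Real.exp (-y) * Real.exp s := by
            rw [← Real.exp_add]; ring_nf
          rw [h2, div_pow]
          calc Real.exp (-y) * y ^ m / m ! = Real.exp (-y) * 2 ^ m * (y ^ m / 2 ^ m / m !) := by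
                field_simp
            _ ≤ _ := by gcongr
        · rw [Set.indicator_of_notMem (show m ∉ {m : ℕ | (m : ℝ) < s} from hm)]
          exact zero_le
    _ = ENNReal.ofReal (Real.exp (s - y / 2)) := by
        rw [ENNReal.tsum_mul_left, tsum_ofReal_pow_div_factorial (by positivity),
          ← ENNReal.ofReal_mul (Real.exp_nonneg _), ← Real.exp_add]
        ring_nf
    _ ≤ _ := by
        apply ENNReal.ofReal_le_ofReal
        gcongr
        linarith

theorem tsum_indicator_iidSamples_le {ι : Type*} (μ : PMF ι) (n : ℕ) (s : Set (Fin n → ι))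
    (c : ℝ≥0∞) (g : ι → ℝ≥0∞) (h : ∀ ω ∈ s, 1 ≤ c * ∏ i, g (ω i)) :
    ∑' ω, s.indicator (iidSamples μ n) ω ≤ c * (∑' a, μ a * g a) ^ n := by
  calc ∑' ω, s.indicator (iidSamples μ n) ω ≤ ∑' ω : Fin n → ι, c * ∏ i, (μ (ω i) * g (ω i)) := by
        refine ENNReal.tsum_le_tsum fun ω => ?_
        by_cases hω : ω ∈ s
        · rw [Set.indicator_of_mem hω, iidSamples_apply, Finset.prod_mul_distrib, mul_left_comm]
          exact le_mul_of_one_le_right zero_le (h ω hω)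
        · rw [Set.indicator_of_notMem hω]
          exact zero_le
    _ = _ := by rw [ENNReal.tsum_mul_left, tsum_prod_fin_arrow n fun a => μ a * g a]

end Histogram

/-! ### Poissonized histograms and conditioning on good outcomes. -/

section Poissonization
open ENNReal Nat

variable {ι : Type} (μ : PMF ι) (x : ι → ℝ) (ρ : ℝ) (n : ℕ)

/-- The joint law of `n` independent draws `ω` from `μ` and of a Poisson variable whose rate is
`ρ` times the total of `x` along `ω`. -/
noncomputable def poissonizedLaw (hx : ∀ a, 0 ≤ x a) (hρ : 0 ≤ ρ) : PMF ((Fin n → ι) × ℕ) :=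
  (iidSamples μ n).bind fun ω =>
    (poissonLaw (ρ * ∑ i, x (ω i))
      (mul_nonneg hρ (Finset.sum_nonneg fun _ _ => hx _))).map fun m => (ω, m)

variable {x ρ}

theorem tsum_poissonizedLaw_mul (hx : ∀ a, 0 ≤ x a) (hρ : 0 ≤ ρ)
    (F : (Fin n → ι) × ℕ → ℝ≥0∞) :
    ∑' z, poissonizedLaw μ x ρ n hx hρ z * F z =
      ∑' ω, iidSamples μ n ω *
        ∑' m, ENNReal.ofReal (poissonWeight (ρ * ∑ i, x (ω i)) m) * F (ω, m) := by
  classical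
  have h : ∀ ω m, poissonizedLaw μ x ρ n hx hρ (ω, m) =
      iidSamples μ n ω * ENNReal.ofReal (poissonWeight (ρ * ∑ i, x (ω i)) m) := by
    intro ω m
    rw [poissonizedLaw, PMF.bind_apply, tsum_eq_single ω, PMF.map_apply, tsum_eq_single m]
    · rw [if_pos rfl, poissonLaw_apply]
    · intro m' hm'
      rw [if_neg]
      intro e
      exact hm' (Prod.ext_iff.mp e).2.symm
    · intro ω' hω'
      rw [PMF.map_apply, ENNReal.tsum_eq_zero.mpr, mul_zero]
      intro m'
      rw [if_neg]
      intro e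
      exact hω' (Prod.ext_iff.mp e).1.symm
  rw [ENNReal.tsum_prod']
  simp only [h, mul_assoc, ENNReal.tsum_mul_left]

/-- Poissonization makes the entries of the histogram independent. -/
theorem poissonizedLaw_bind_histogramOf_apply (hx : ∀ a, 0 ≤ x a) (hρ : 0 ≤ ρ)
    (P : (Fin n → ι) → PMF (Fin n))
    (hP : ∀ ω i, x (ω i) = (∑ j, x (ω j)) * (P ω i).toReal) (h : Fin n → ℕ) :
    (poissonizedLaw μ x ρ n hx hρ).bind (fun z => histogramOf (P z.1) z.2) h =
      ∏ i, ∑' a, μ a * ENNReal.ofReal (poissonWeight (ρ * x a) (h i)) := by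
  rw [PMF.bind_apply, tsum_poissonizedLaw_mul μ n hx hρ fun z => histogramOf (P z.1) z.2 h]
  have h1 : ∀ ω : Fin n → ι, ∑' m, ENNReal.ofReal (poissonWeight (ρ * ∑ i, x (ω i)) m) *
      histogramOf (P ω) m h = ∏ i, ENNReal.ofReal (poissonWeight (ρ * x (ω i)) (h i)) := by
    intro ω
    rw [tsum_poissonWeight_mul_histogramOf _
      (mul_nonneg hρ (Finset.sum_nonneg fun _ _ => hx _))]
    exact Finset.prod_congr rfl fun i _ => by rw [mul_assoc, ← hP]
  simp only [h1, iidSamples_apply, ← Finset.prod_mul_distrib]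
  clear h1 hP P
  induction n with
  | zero => simp
  | succ n ih =>
    rw [tsum_fin_succ_arrow]
    simp only [Fin.prod_univ_succ, Fin.cons_zero, Fin.cons_succ, ENNReal.tsum_mul_left,
      ENNReal.tsum_mul_right]
    rw [ih fun i => h i.succ]

/-- The class and the sample size must be right always, not just with high probability. Bad outcomes
are therefore redirected to one fixed good outcome, which moves the law by at most twice their
probability in ℓ¹. -/
theorem exists_isHistogramLaw_near (hx : ∀ a, 0 ≤ x a) (hρ : 0 ≤ ρ)
    (P : (Fin n → ι) → PMF (Fin n)) (𝒮 : Set (PMF (Fin n))) (s Smin : ℝ) (G : Set (Fin n → ι))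
    (hG : ∀ ω ∈ G, P ω ∈ 𝒮 ∧ Smin ≤ ∑ i, x (ω i)) (hs : s ≤ ρ * Smin / 4) {δ : ℝ≥0∞}
    (hδ : ∑' ω, Gᶜ.indicator (iidSamples μ n) ω + ENNReal.ofReal (Real.exp (-(ρ * Smin / 4))) ≤ δ)
    (hδ1 : δ < 1) :
    ∃ H : PMF (Fin n → ℕ), IsHistogramLaw 𝒮 s H ∧
      ∑' h, ennDist (H h) ((poissonizedLaw μ x ρ n hx hρ).bind
        (fun z => histogramOf (P z.1) z.2) h) ≤ 2 * δ := by
  classical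
  set Z := poissonizedLaw μ x ρ n hx hρ with hZ
  set good : Set ((Fin n → ι) × ℕ) := {z | z.1 ∈ G ∧ s ≤ z.2} with hgood
  have hbad : ∑' z, goodᶜ.indicator Z z ≤ δ := by
    refine le_trans ?_ hδ
    have e : ∀ z, goodᶜ.indicator Z z = Z z * goodᶜ.indicator 1 z := fun z => by
      by_cases hz : z ∈ goodᶜ <;> simp [hz]
    simp only [e]
    rw [hZ, tsum_poissonizedLaw_mul]
    calc _ ≤ ∑' ω, (Gᶜ.indicator (iidSamples μ n) ω +
            iidSamples μ n ω * ENNReal.ofReal (Real.exp (-(ρ * Smin / 4)))) := by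
          refine ENNReal.tsum_le_tsum fun ω => ?_
          have hS : 0 ≤ ρ * ∑ i, x (ω i) :=
            mul_nonneg hρ (Finset.sum_nonneg fun _ _ => hx _)
          by_cases hω : ω ∈ G
          · refine le_add_left ?_
            gcongr
            have hS2 : ρ * Smin ≤ ρ * ∑ i, x (ω i) := by gcongr; exact (hG ω hω).2
            refine le_trans ?_ ((tsum_poissonLaw_lt_le hS (s := s) (by linarith)).trans ?_)
            · refine ENNReal.tsum_le_tsum fun m => ?_
              by_cases hm : (m : ℝ) < s
              · rw [Set.indicator_of_mem (show m ∈ {m : ℕ | (m : ℝ) < s} from hm),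
                  poissonLaw_apply]
                exact mul_le_of_le_one_right zero_le
                  (Set.indicator_le (fun _ _ => le_rfl) _)
              · rw [Set.indicator_of_notMem, mul_zero]
                · exact zero_le
                · simp only [hgood, Set.mem_compl_iff, not_not]
                  exact ⟨hω, not_lt.mp hm⟩
            · apply ENNReal.ofReal_le_ofReal
              gcongr
          · refine le_add_right ?_
            rw [Set.indicator_of_mem (show ω ∈ Gᶜ from hω)]
            refine mul_le_of_le_one_right zero_le ?_
            calc _ ≤ ∑' m, ENNReal.ofReal (poissonWeight (ρ * ∑ i, x (ω i)) m) := by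
                  refine ENNReal.tsum_le_tsum fun m => ?_
                  exact mul_le_of_le_one_right zero_le
                    (Set.indicator_le (fun _ _ => le_rfl) _)
              _ = 1 := tsum_ofReal_poissonWeight hS
      _ = _ := by
          rw [ENNReal.tsum_add, ENNReal.tsum_mul_right, PMF.tsum_coe, one_mul]
  obtain ⟨z₀, hz₀⟩ : good.Nonempty := by
    by_contra hne
    rw [Set.not_nonempty_iff_eq_empty] at hne
    rw [hne] at hbad
    simp only [Set.compl_empty, Set.indicator_univ, PMF.tsum_coe] at hbad
    exact absurd hδ1 (not_lt.mpr hbad)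
  let f : (Fin n → ι) × ℕ → PMF (Fin n) × ℕ := fun z =>
    if z ∈ good then (P z.1, z.2) else (P z₀.1, z₀.2)
  refine ⟨(Z.map f).bind fun pm => histogramOf pm.1 pm.2, ⟨Z.map f, ?_, rfl⟩, ?_⟩
  · intro pm hpm
    rw [PMF.mem_support_map_iff] at hpm
    obtain ⟨z, _, rfl⟩ := hpm
    simp only [f]
    split_ifs with hz
    · exact ⟨(hG _ hz.1).1, hz.2⟩
    · exact ⟨(hG _ hz₀.1).1, hz₀.2⟩
  · rw [PMF.bind_map]
    refine (tsum_ennDist_bind_le Z _ _ goodᶜ ?_).trans (by gcongr)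
    intro z hz
    simp only [Set.mem_compl_iff, not_not] at hz
    simp [f, hz]

end Poissonization

/-! ### Concentration of the total score and of the number of zeros. -/

section Deviation
open ENNReal

variable {ι : Type} [Fintype ι]

/-- The law on a finite type with the given real weights. -/
noncomputable def weightLaw (w : ι → ℝ) (hw : ∀ a, 0 ≤ w a) (hw1 : ∑ a, w a = 1) : PMF ι :=
  PMF.ofFintype (fun a => ENNReal.ofReal (w a)) (by
    rw [← ENNReal.ofReal_sum_of_nonneg fun a _ => hw a, hw1, ENNReal.ofReal_one])

theorem tsum_weightLaw_mul_ofReal {w : ι → ℝ} (hw : ∀ a, 0 ≤ w a) (hw1 : ∑ a, w a = 1)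
    {g : ι → ℝ} (hg : ∀ a, 0 ≤ g a) :
    ∑' a, weightLaw w hw hw1 a * ENNReal.ofReal (g a) = ENNReal.ofReal (∑ a, w a * g a) := by
  rw [tsum_fintype, ENNReal.ofReal_sum_of_nonneg fun a _ => mul_nonneg (hw a) (hg a)]
  exact Finset.sum_congr rfl fun a _ => by
    rw [ENNReal.ofReal_mul (hw a), weightLaw, PMF.ofFintype_apply]

theorem tsum_indicator_iidSamples_weightLaw_le {w : ι → ℝ} (hw : ∀ a, 0 ≤ w a)
    (hw1 : ∑ a, w a = 1) (n : ℕ) (s : Set (Fin n → ι)) (t κ : ℝ) (g : ι → ℝ)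
    (h : ∀ ω ∈ s, 0 ≤ t + ∑ i, g (ω i)) (hκ : ∑ a, w a * Real.exp (g a) ≤ 1 + κ) :
    ∑' ω, s.indicator (iidSamples (weightLaw w hw hw1) n) ω ≤
      ENNReal.ofReal (Real.exp (t + n * κ)) := by
  refine (tsum_indicator_iidSamples_le _ n s (ENNReal.ofReal (Real.exp t))
    (fun a => ENNReal.ofReal (Real.exp (g a))) ?_).trans ?_
  · intro ω hω
    rw [← ENNReal.ofReal_prod_of_nonneg fun i _ => Real.exp_nonneg _,
      ← ENNReal.ofReal_mul (Real.exp_nonneg _), ← Real.exp_sum, ← Real.exp_add]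
    exact ENNReal.one_le_ofReal.mpr (Real.one_le_exp (h ω hω))
  · rw [tsum_weightLaw_mul_ofReal hw hw1 fun a => Real.exp_nonneg _,
      ← ENNReal.ofReal_pow (Finset.sum_nonneg fun a _ => mul_nonneg (hw a) (Real.exp_nonneg _)),
      ← ENNReal.ofReal_mul (Real.exp_nonneg _)]
    apply ENNReal.ofReal_le_ofReal
    rw [Real.exp_add, Real.exp_nat_mul]
    gcongr
    · exact Finset.sum_nonneg fun a _ => mul_nonneg (hw a) (Real.exp_nonneg _)
    · exact hκ.trans (by linarith [Real.add_one_le_exp κ])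

/-- Chernoff bound with exponent x/b in [0, 1], where e^v ≤ 1 + 2v. -/
theorem tsum_indicator_sum_gt_le {w x : ι → ℝ} (hw : ∀ a, 0 ≤ w a) (hw1 : ∑ a, w a = 1)
    {b : ℝ} (hb : 0 < b) (hx : ∀ a, 0 ≤ x a) (hxb : ∀ a, x a ≤ b) (hm : ∑ a, w a * x a ≤ 2)
    (n : ℕ) :
    ∑' ω, {ω : Fin n → ι | 5 * (n : ℝ) < ∑ i, x (ω i)}.indicator
      (iidSamples (weightLaw w hw hw1) n) ω ≤ ENNReal.ofReal (Real.exp (-(n / (8 * b)))) := by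
  refine (tsum_indicator_iidSamples_weightLaw_le hw hw1 n _ (-(5 * n / b)) (4 / b)
    (fun a => x a / b) ?_ ?_).trans ?_
  · intro ω hω
    rw [← Finset.sum_div, ← sub_eq_neg_add, ← sub_div]
    exact div_nonneg (sub_nonneg.mpr (le_of_lt hω)) hb.le
  · have h1 : ∀ a, Real.exp (x a / b) ≤ 1 + 2 * (x a / b) := by
      intro a
      have h0 : 0 ≤ x a / b := div_nonneg (hx a) hb.le
      have h2 : x a / b ≤ 1 := (div_le_one hb).mpr (hxb a)
      have := (abs_le.mp (Real.abs_exp_sub_one_sub_id_le (x := x a / b)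
        (by rw [abs_of_nonneg h0]; exact h2))).2
      nlinarith
    calc ∑ a, w a * Real.exp (x a / b) ≤ ∑ a, w a * (1 + 2 * (x a / b)) := by
          gcongr with a
          · exact hw a
          · exact h1 a
      _ = ∑ a, w a + 2 / b * ∑ a, w a * x a := by
          rw [Finset.mul_sum, ← Finset.sum_add_distrib]
          exact Finset.sum_congr rfl fun a _ => by ring
      _ ≤ 1 + 2 / b * 2 := by rw [hw1]; gcongr
      _ = 1 + 4 / b := by ring
  · apply ENNReal.ofReal_le_ofReal
    gcongr
    have e : -(5 * n / b) + n * (4 / b) = -(n / b) := by ring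
    rw [e]
    gcongr
    linarith

theorem tsum_indicator_sum_lt_le {w x : ι → ℝ} (hw : ∀ a, 0 ≤ w a) (hw1 : ∑ a, w a = 1)
    {b : ℝ} (hb : 0 < b) (hx : ∀ a, 0 ≤ x a) (hxb : ∀ a, x a ≤ b) (hm : 1 ≤ ∑ a, w a * x a)
    (n : ℕ) :
    ∑' ω, {ω : Fin n → ι | ∑ i, x (ω i) < (n : ℝ) / 4}.indicator
      (iidSamples (weightLaw w hw hw1) n) ω ≤ ENNReal.ofReal (Real.exp (-(n / (8 * b)))) := by
  refine (tsum_indicator_iidSamples_weightLaw_le hw hw1 n _ (n / (8 * b)) (-(1 / (4 * b)))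
    (fun a => -(x a / (2 * b))) ?_ ?_).trans ?_
  · intro ω hω
    have hω' : ∑ i, x (ω i) < (n : ℝ) / 4 := hω
    rw [Finset.sum_neg_distrib, ← Finset.sum_div, ← sub_eq_add_neg, sub_nonneg,
      div_le_div_iff₀ (by positivity) (by positivity)]
    nlinarith
  · have h1 : ∀ a, Real.exp (-(x a / (2 * b))) ≤ 1 - x a / (4 * b) := by
      intro a
      have h0 : 0 ≤ x a / (2 * b) := div_nonneg (hx a) (by linarith)
      have h2 : x a / (2 * b) ≤ 1 / 2 := by
        rw [div_le_div_iff₀ (by positivity) (by norm_num)]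
        linarith [hxb a]
      have := (abs_le.mp (Real.abs_exp_sub_one_sub_id_le (x := -(x a / (2 * b)))
        (by rw [abs_neg, abs_of_nonneg h0]; linarith))).2
      have e : x a / (4 * b) = x a / (2 * b) / 2 := by field_simp; ring
      rw [e]
      nlinarith
    calc ∑ a, w a * Real.exp (-(x a / (2 * b))) ≤ ∑ a, w a * (1 - x a / (4 * b)) := by
          gcongr with a
          · exact hw a
          · exact h1 a
      _ = ∑ a, w a - 1 / (4 * b) * ∑ a, w a * x a := by
          rw [Finset.mul_sum, ← Finset.sum_sub_distrib]
          exact Finset.sum_congr rfl fun a _ => by ring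
      _ ≤ 1 - 1 / (4 * b) * 1 := by rw [hw1]; gcongr
      _ = 1 + -(1 / (4 * b)) := by ring
  · apply ENNReal.ofReal_le_ofReal
    gcongr
    apply le_of_eq
    field_simp
    ring

open Classical in
theorem tsum_indicator_card_lt_le {w : ι → ℝ} (hw : ∀ a, 0 ≤ w a) (hw1 : ∑ a, w a = 1)
    (a₀ : ι) {q : ℝ} (hq0 : 0 ≤ q) (hq : q ≤ w a₀) (n : ℕ) :
    ∑' ω, {ω : Fin n → ι | ((Finset.univ.filter fun i => ω i = a₀).card : ℝ) < n * q / 4}.indicator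
      (iidSamples (weightLaw w hw hw1) n) ω ≤ ENNReal.ofReal (Real.exp (-(n * q / 4))) := by
  refine (tsum_indicator_iidSamples_weightLaw_le hw hw1 n _ (n * q / 4) (-(q / 2))
    (fun a => if a = a₀ then -1 else 0) ?_ ?_).trans ?_
  · intro ω hω
    have hω' : ((Finset.univ.filter fun i => ω i = a₀).card : ℝ) < n * q / 4 := hω
    rw [← Finset.sum_filter, Finset.sum_const, nsmul_eq_mul]
    linarith
  · have h1 : ∀ a, w a * Real.exp (if a = a₀ then -1 else 0) =
        w a - if a = a₀ then w a * (1 - Real.exp (-1)) else 0 := by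
      intro a
      split_ifs
      · ring
      · simp
    rw [Finset.sum_congr rfl fun a _ => h1 a, Finset.sum_sub_distrib, hw1]
    simp only [Finset.sum_ite_eq', Finset.mem_univ, if_true]
    have h2 : Real.exp (-1) ≤ 1 / 2 := by
      rw [Real.exp_neg, inv_le_comm₀ (Real.exp_pos _) (by norm_num)]
      have := Real.add_one_le_exp 1
      norm_num
      linarith
    nlinarith
  · apply ENNReal.ofReal_le_ofReal
    gcongr
    linarith

end Deviation

/-! ### Normalized scores and distance from bigness. -/

section Normalize

theorem exists_pmf_proportional {n : ℕ} (hn : 0 < n) (v : Fin n → ℝ) (hv : ∀ i, 0 ≤ v i) :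
    ∃ p : PMF (Fin n), ∀ i, v i = (∑ j, v j) * (p i).toReal := by
  rcases (Finset.sum_nonneg fun i (_ : i ∈ Finset.univ) => hv i).eq_or_lt' with h | h
  · refine ⟨PMF.pure ⟨0, hn⟩, fun i => ?_⟩
    rw [h, zero_mul]
    exact (Finset.sum_eq_zero_iff_of_nonneg fun i _ => hv i).mp h i (Finset.mem_univ i)
  · refine ⟨weightLaw (fun i => v i / ∑ j, v j) (fun i => div_nonneg (hv i) h.le) ?_, fun i => ?_⟩
    · rw [← Finset.sum_div, div_self h.ne']
    · rw [weightLaw, PMF.ofFintype_apply, ENNReal.toReal_ofReal (div_nonneg (hv i) h.le)]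
      field_simp

theorem sum_toReal_eq_one {n : ℕ} (p : PMF (Fin n)) : ∑ i, (p i).toReal = 1 := by
  have := p.tsum_coe
  rw [tsum_fintype] at this
  rw [← ENNReal.toReal_sum fun i _ => p.apply_ne_top i, this, ENNReal.toReal_one]

/-- A big q exceeds p by at least T at each zero. As p - q sums to 0, summing |p - q| - (p - q)
gives the full ℓ¹ norm. The uniform law shows that the infimum is over a nonempty set. -/
theorem isFarFromBig_of_card_zeros {n : ℕ} {ε T : ℝ} (hTn : n * T ≤ 1)
    (p : PMF (Fin n)) (z : Finset (Fin n)) (hz : ∀ i ∈ z, (p i).toReal = 0)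
    (hcard : ε ≤ z.card * T) : IsFarFromBig ε T p := by
  have hn : 0 < n := by
    rcases Nat.eq_zero_or_pos n with rfl | h
    · exact (by simpa using sum_toReal_eq_one p : False).elim
    · exact h
  have hn' : (0 : ℝ) < n := Nat.cast_pos.mpr hn
  have hne : Nonempty {q : PMF (Fin n) // IsBig T q} := by
    refine ⟨weightLaw (fun _ => 1 / (n : ℝ)) (fun _ => by positivity) ?_, fun i => ?_⟩
    · simp [hn'.ne']
    · rw [weightLaw, PMF.ofFintype_apply, ENNReal.toReal_ofReal (by positivity),
        le_div_iff₀ hn']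
      linarith
  refine le_ciInf fun q => hcard.trans ?_
  unfold tvDist
  rw [tsum_fintype]
  have h1 : ∀ i, (if i ∈ z then 2 * T else 0) ≤
      |(p i).toReal - (q.1 i).toReal| - ((p i).toReal - (q.1 i).toReal) := by
    intro i
    split_ifs with h
    · have := q.2 i
      rw [hz i h, zero_sub, abs_neg, abs_of_nonneg ENNReal.toReal_nonneg]
      linarith
    · exact sub_nonneg.mpr (le_abs_self _)
  have h2 := Finset.sum_le_sum fun i (_ : i ∈ Finset.univ) => h1 i
  rw [Finset.sum_sub_distrib, Finset.sum_sub_distrib, sum_toReal_eq_one, sum_toReal_eq_one,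
    ← Finset.sum_filter, Finset.sum_const, nsmul_eq_mul] at h2
  simp only [Finset.filter_mem_eq_inter, Finset.univ_inter] at h2
  linarith

end Normalize

/-! ### From a matched pair to the two histogram laws. -/

section Assembly
open ENNReal Nat

theorem tsum_ennDist_poissonMixture_le {ι : Type} [Fintype ι] {L : ℕ} {b q ρ : ℝ}
    {x wp wm : ι → ℝ} (h : IsMatchedPair L b q x wp wm) (hwm1 : ∑ a, wm a = 1) (hρ : 0 ≤ ρ) :
    ∑' j, ennDist
      (∑' a, weightLaw wp h.wp_nonneg h.wp_sum a * ENNReal.ofReal (poissonWeight (ρ * x a) j))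
      (∑' a, weightLaw wm h.wm_nonneg hwm1 a * ENNReal.ofReal (poissonWeight (ρ * x a) j)) ≤
    ENNReal.ofReal (2 * (3 * (ρ * b)) ^ (L + 1) / (L + 1)!) := by
  have hy0 : ∀ a, 0 ≤ ρ * x a := fun a => mul_nonneg hρ (h.nonneg a)
  have hw := fun j a => poissonWeight_nonneg (hy0 a) j
  refine le_trans (le_of_eq ?_) (tsum_abs_sum_mul_poissonWeight_le (N := L + 1) (Λ := ρ * b)
    (c := 2) (fun a => wp a - wm a) (fun a => ρ * x a) hy0 ?_ ?_ ?_)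
  · refine tsum_congr fun j => ?_
    rw [tsum_weightLaw_mul_ofReal _ _ (hw j), tsum_weightLaw_mul_ofReal _ _ (hw j),
      ennDist_ofReal, ← Finset.sum_sub_distrib]
    · simp only [sub_mul]
    · exact Finset.sum_nonneg fun a _ => mul_nonneg (h.wp_nonneg a) (hw j a)
    · exact Finset.sum_nonneg fun a _ => mul_nonneg (h.wm_nonneg a) (hw j a)
  · intro a
    exact mul_le_mul_of_nonneg_left (h.le a) hρ
  · calc ∑ a, |wp a - wm a| ≤ ∑ a, (wp a + wm a) := by
          refine Finset.sum_le_sum fun a _ => abs_le.mpr ⟨?_, ?_⟩ <;>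
            linarith [h.wp_nonneg a, h.wm_nonneg a]
      _ = 2 := by rw [Finset.sum_add_distrib, h.wp_sum, hwm1]; norm_num
  · intro k hk
    have := h.moments k (Nat.lt_succ_iff.mp hk)
    calc ∑ a, (wp a - wm a) * (ρ * x a) ^ k
        = ρ ^ k * (∑ a, wp a * x a ^ k - ∑ a, wm a * x a ^ k) := by
          rw [← Finset.sum_sub_distrib, Finset.mul_sum]
          exact Finset.sum_congr rfl fun a _ => by rw [mul_pow]; ring
      _ = 0 := by rw [this, sub_self, mul_zero]

theorem exists_histogramLaws_of_isMatchedPair {ι : Type} [Fintype ι] {L : ℕ} (hL : 1 ≤ L)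
    {b q ρ ε s : ℝ} {x wp wm : ι → ℝ} (h : IsMatchedPair L b q x wp wm) {n : ℕ} (hn : 0 < n)
    (hb : 0 < b) (hq : 0 ≤ q) (hρ : 0 ≤ ρ) (hε : 20 * ε ≤ q) (hs : s ≤ ρ * n / 16)
    (hδ : 2 * Real.exp (-(n / (8 * b))) + Real.exp (-(n * q / 4)) + Real.exp (-(ρ * n / 16)) ≤
      1 / 400)
    (htv : n * (2 * (3 * (ρ * b)) ^ (L + 1) / (L + 1)!) ≤ 0.01) :
    ∃ Hplus Hminus : PMF (Fin n → ℕ),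
      IsHistogramLaw {p | IsBig (1 / (5 * n)) p ∧ ∀ i, (p i).toReal ≤ 4 * b / n} s Hplus ∧
      IsHistogramLaw {p | IsFarFromBig ε (1 / (5 * n)) p ∧ ∀ i, (p i).toReal ≤ 4 * b / n} s
        Hminus ∧
      tvDist Hplus Hminus ≤ 0.01 := by
  classical
  have hn' : (0 : ℝ) < n := Nat.cast_pos.mpr hn
  have hwm1 : ∑ a, wm a = 1 := by
    have := h.moments 0 (Nat.zero_le _)
    simpa [h.wp_sum] using this.symm
  have hmean : ∑ a, wm a * x a = ∑ a, wp a * x a := by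
    simpa using (h.moments 1 hL).symm
  set μp := weightLaw wp h.wp_nonneg h.wp_sum with hμp
  set μm := weightLaw wm h.wm_nonneg hwm1 with hμm
  obtain ⟨a₀, ha₀, hqa₀⟩ := h.zero_mass
  choose P hP using fun ω : Fin n → ι =>
    exists_pmf_proportional hn (fun i => x (ω i)) fun i => h.nonneg _
  have hle : ∀ ω : Fin n → ι, (n : ℝ) / 4 ≤ ∑ i, x (ω i) → ∀ i, (P ω i).toReal ≤ 4 * b / n := by
    intro ω hω i
    have h1 := hP ω i
    have h2 := h.le (ω i)
    rw [le_div_iff₀ hn']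
    have h3 : (0 : ℝ) ≤ (P ω i).toReal := toReal_nonneg
    nlinarith
  set E1 := Real.exp (-(n / (8 * b)))
  set E2 := Real.exp (-(n * q / 4))
  set E3 := Real.exp (-(ρ * n / 16))
  have hE1 : 0 ≤ E1 := Real.exp_nonneg _
  have hE2 : 0 ≤ E2 := Real.exp_nonneg _
  have hE3 : 0 ≤ E3 := Real.exp_nonneg _
  have hE3' : Real.exp (-(ρ * (n / 4) / 4)) = E3 := by
    simp only [E3]
    congr 1
    ring
  have hlt : ENNReal.ofReal (1 / 400) < 1 := by
    rw [ENNReal.ofReal_lt_one]; norm_num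
  have union_le : ∀ (D : (Fin n → ι) → ℝ≥0∞) (A B C : Set (Fin n → ι)), A ⊆ B ∪ C →
      ∑' ω, A.indicator D ω ≤ ∑' ω, B.indicator D ω + ∑' ω, C.indicator D ω := by
    intro D A B C hABC
    rw [← ENNReal.tsum_add]
    refine ENNReal.tsum_le_tsum fun ω => ?_
    by_cases hA : ω ∈ A
    · rw [Set.indicator_of_mem hA]
      rcases hABC hA with hB | hC
      · rw [Set.indicator_of_mem hB]; exact le_self_add
      · rw [Set.indicator_of_mem hC]; exact le_add_self
    · rw [Set.indicator_of_notMem hA]; exact zero_le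
  obtain ⟨Hp, hHp, hHp'⟩ := exists_isHistogramLaw_near μp n h.nonneg hρ P
    {p | IsBig (1 / (5 * n)) p ∧ ∀ i, (p i).toReal ≤ 4 * b / n} s (n / 4)
    {ω | (∀ i, wp (ω i) ≠ 0) ∧ (∑ i, x (ω i) ≤ 5 * n) ∧ (n : ℝ) / 4 ≤ ∑ i, x (ω i)}
    (by
      rintro ω ⟨h0, h1, h2⟩
      refine ⟨⟨fun i => ?_, hle ω h2⟩, h2⟩
      have h3 := hP ω i
      have h4 := h.one_le _ (h0 i)
      rw [div_le_iff₀ (by positivity)]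
      have h5 : (0 : ℝ) ≤ (P ω i).toReal := toReal_nonneg
      nlinarith)
    (by linarith) (δ := ENNReal.ofReal (1 / 400))
    (by
      refine le_trans (add_le_add (b := ENNReal.ofReal (E1 + E1)) ?_ le_rfl) ?_
      · have hsupp : ∀ ω : Fin n → ι, ¬ (∀ i, wp (ω i) ≠ 0) → iidSamples μp n ω = 0 := by
          intro ω hω
          push Not at hω
          obtain ⟨i, hi⟩ := hω
          rw [iidSamples_apply, Finset.prod_eq_zero (Finset.mem_univ i)]
          rw [hμp, weightLaw, PMF.ofFintype_apply, hi, ENNReal.ofReal_zero]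
        rw [ENNReal.ofReal_add hE1 hE1]
        refine le_trans ?_ (add_le_add
          (tsum_indicator_sum_gt_le h.wp_nonneg h.wp_sum hb h.nonneg h.le h.mean_le n)
          (tsum_indicator_sum_lt_le h.wp_nonneg h.wp_sum hb h.nonneg h.le h.one_le_mean n))
        rw [← ENNReal.tsum_add]
        refine ENNReal.tsum_le_tsum fun ω => ?_
        by_cases h0 : ∀ i, wp (ω i) ≠ 0
        · by_cases h1 : ∑ i, x (ω i) ≤ 5 * n
          · by_cases h2 : (n : ℝ) / 4 ≤ ∑ i, x (ω i)
            · rw [Set.indicator_of_notMem]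
              · exact zero_le
              · simp only [Set.mem_compl_iff, not_not]
                exact ⟨h0, h1, h2⟩
            · refine le_add_left ?_
              rw [Set.indicator_of_mem (s := {ω : Fin n → ι | ∑ i, x (ω i) < (n : ℝ) / 4})
                (not_le.mp h2)]
              exact Set.indicator_le (fun _ _ => le_rfl) _
          · refine le_add_right ?_
            rw [Set.indicator_of_mem (s := {ω : Fin n → ι | 5 * (n : ℝ) < ∑ i, x (ω i)})
              (not_le.mp h1)]
            exact Set.indicator_le (fun _ _ => le_rfl) _
        · refine le_trans (Set.indicator_le (fun _ _ => le_rfl) _) ?_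
          rw [hsupp ω h0]
          exact zero_le
      · rw [hE3', ← ENNReal.ofReal_add (by positivity) hE3]
        apply ENNReal.ofReal_le_ofReal
        linarith)
    hlt
  obtain ⟨Hm, hHm, hHm'⟩ := exists_isHistogramLaw_near μm n h.nonneg hρ P
    {p | IsFarFromBig ε (1 / (5 * n)) p ∧ ∀ i, (p i).toReal ≤ 4 * b / n} s (n / 4)
    {ω | (n * q / 4 ≤ ((Finset.univ.filter fun i => ω i = a₀).card : ℝ)) ∧
      (n : ℝ) / 4 ≤ ∑ i, x (ω i)}
    (by
      rintro ω ⟨h0, h2⟩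
      refine ⟨⟨?_, hle ω h2⟩, h2⟩
      refine isFarFromBig_of_card_zeros ?_ _
        (Finset.univ.filter fun i => ω i = a₀) ?_ ?_
      · rw [mul_one_div, div_le_one (by positivity)]
        linarith
      · intro i hi
        have h3 := hP ω i
        rw [(Finset.mem_filter.mp hi).2, ha₀] at h3
        rcases mul_eq_zero.mp h3.symm with h4 | h4
        · linarith
        · exact h4
      · rw [mul_one_div, le_div_iff₀ (by positivity)]
        nlinarith)
    (by linarith) (δ := ENNReal.ofReal (1 / 400))
    (by
      refine le_trans (add_le_add (b := ENNReal.ofReal (E2 + E1)) ?_ le_rfl) ?_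
      · rw [ENNReal.ofReal_add hE2 hE1]
        refine le_trans (union_le _ _ _ _ ?_) (add_le_add
          (tsum_indicator_card_lt_le h.wm_nonneg hwm1 a₀ hq hqa₀ n)
          (tsum_indicator_sum_lt_le h.wm_nonneg hwm1 hb h.nonneg h.le
            (by rw [hmean]; exact h.one_le_mean) n))
        intro ω hω
        by_contra hcon
        rw [Set.mem_union, not_or] at hcon
        exact hω ⟨not_lt.mp hcon.1, not_lt.mp hcon.2⟩
      · rw [hE3', ← ENNReal.ofReal_add (by positivity) hE3]
        apply ENNReal.ofReal_le_ofReal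
        linarith)
    hlt
  refine ⟨Hp, Hm, hHp, hHm, tvDist_le_of_tsum_ennDist_le _ _ (by norm_num) ?_⟩
  set Fp := (poissonizedLaw μp x ρ n h.nonneg hρ).bind fun z => histogramOf (P z.1) z.2 with hFp
  set Fm := (poissonizedLaw μm x ρ n h.nonneg hρ).bind fun z => histogramOf (P z.1) z.2 with hFm
  have hmid : ∑' k, ennDist (Fp k) (Fm k) ≤ ENNReal.ofReal 0.01 := by
    simp only [hFp, hFm, poissonizedLaw_bind_histogramOf_apply _ n h.nonneg hρ P hP]
    have hone : ∀ μ : PMF ι, ∑' j, ∑' a, μ a * ENNReal.ofReal (poissonWeight (ρ * x a) j) = 1 := by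
      intro μ
      rw [ENNReal.tsum_comm]
      simp only [ENNReal.tsum_mul_left,
        tsum_ofReal_poissonWeight (mul_nonneg hρ (h.nonneg _)), mul_one, PMF.tsum_coe]
    refine (tsum_ennDist_prod_le n (hone μp) (hone μm)).trans ?_
    calc (n : ℝ≥0∞) * _
        ≤ n * ENNReal.ofReal (2 * (3 * (ρ * b)) ^ (L + 1) / (L + 1)!) := by
          gcongr
          exact tsum_ennDist_poissonMixture_le h hwm1 hρ
      _ = ENNReal.ofReal (n * (2 * (3 * (ρ * b)) ^ (L + 1) / (L + 1)!)) := by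
          rw [ENNReal.ofReal_mul hn'.le, ENNReal.ofReal_natCast]
      _ ≤ _ := ENNReal.ofReal_le_ofReal htv
  -- Error budget in ℓ¹: 2/400 for each redirection and 0.01 between the Poissonized laws, 0.02 in
  -- all.
  calc ∑' k, ennDist (Hp k) (Hm k)
      ≤ ∑' k, ennDist (Hp k) (Fp k) + (∑' k, ennDist (Fp k) (Fm k) +
          ∑' k, ennDist (Fm k) (Hm k)) :=
        (tsum_ennDist_triangle _ _ _).trans (add_le_add le_rfl (tsum_ennDist_triangle _ _ _))
    _ ≤ 2 * ENNReal.ofReal (1 / 400) + (ENNReal.ofReal 0.01 + 2 * ENNReal.ofReal (1 / 400)) := by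
        gcongr
        simp only [ennDist_comm (Fm _)]
        exact hHm'
    _ = ENNReal.ofReal (2 * 0.01) := by
        rw [← ENNReal.ofReal_ofNat 2, ← ENNReal.ofReal_mul (by norm_num),
          ← ENNReal.ofReal_add (by norm_num) (by norm_num),
          ← ENNReal.ofReal_add (by norm_num) (by norm_num)]
        norm_num

end Assembly

/-! ### Numerical estimates and choice of parameters. -/

theorem eventually_mul_log_le_sqrt (K : ℝ) :
    ∃ n₀ : ℕ, ∀ n : ℕ, n₀ ≤ n → K * Real.log n ≤ Real.sqrt n := by
  have h := (isLittleO_log_rpow_atTop (show (0 : ℝ) < 1 / 2 by norm_num)).bound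
    (show (0 : ℝ) < 1 / (|K| + 1) by positivity)
  obtain ⟨N, hN⟩ := Filter.eventually_atTop.mp (tendsto_natCast_atTop_atTop.eventually h)
  refine ⟨N, fun n hn => ?_⟩
  have h1 := hN n hn
  rw [← Real.sqrt_eq_rpow, Real.norm_eq_abs, Real.norm_of_nonneg (Real.sqrt_nonneg _),
    one_div, inv_mul_eq_div, le_div_iff₀ (by positivity)] at h1
  calc K * Real.log n ≤ |K * Real.log n| := le_abs_self _
    _ = |Real.log n| * |K| := by rw [abs_mul, mul_comm]
    _ ≤ |Real.log n| * (|K| + 1) := by gcongr; linarith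
    _ ≤ _ := h1

theorem exp_neg_le_of_twelve_le {y : ℝ} (hy : 12 ≤ y) : Real.exp (-y) ≤ 1 / 1600 := by
  have h1 : (2 : ℝ) ^ 12 ≤ Real.exp 1 ^ 12 := by
    gcongr
    linarith [Real.add_one_le_exp 1]
  rw [← Real.exp_nat_mul] at h1
  have h2 : Real.exp 12 ≤ Real.exp y := Real.exp_le_exp.mpr hy
  norm_num at h1
  rw [Real.exp_neg, inv_le_comm₀ (Real.exp_pos _) (by norm_num)]
  linarith

theorem pow_self_le_exp_one_pow_mul_factorial (N : ℕ) :
    (N : ℝ) ^ N ≤ Real.exp 1 ^ N * N.factorial := by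
  have h := Real.pow_div_factorial_le_exp (N : ℝ) (Nat.cast_nonneg N) N
  rw [div_le_iff₀ (by positivity)] at h
  rwa [← Real.exp_nat_mul, mul_one]

/-- The N-th power of n^(-1/N) cancels n, and N^N/N! ≤ 3^N leaves 2·(1/20)^N. -/
theorem mul_pow_div_factorial_le {n N : ℕ} (hn : 0 < n) (hN : 2 ≤ N) {y : ℝ} (hy0 : 0 ≤ y)
    (hy : y ≤ 1 / 180 * N * (n : ℝ) ^ (-(1 / (N : ℝ)))) :
    n * (2 * (3 * y) ^ N / N.factorial) ≤ 0.01 := by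
  have hn' : (0 : ℝ) < n := Nat.cast_pos.mpr hn
  have hN' : (0 : ℝ) < N := by positivity
  have hpow : ((n : ℝ) ^ (-(1 / (N : ℝ)))) ^ N = (n : ℝ)⁻¹ := by
    rw [← Real.rpow_natCast, ← Real.rpow_mul hn'.le]
    have : -(1 / (N : ℝ)) * N = -1 := by field_simp
    rw [this, Real.rpow_neg_one]
  have hf : (0 : ℝ) < N.factorial := by positivity
  have he : Real.exp 1 ≤ 3 := by linarith [Real.exp_one_lt_d9]
  calc n * (2 * (3 * y) ^ N / N.factorial)
      ≤ n * (2 * (3 * (1 / 180 * N * (n : ℝ) ^ (-(1 / (N : ℝ))))) ^ N / N.factorial) := by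
        gcongr
    _ = 2 * (1 / 60) ^ N * ((N : ℝ) ^ N / N.factorial) := by
        have : 3 * (1 / 180 * N * (n : ℝ) ^ (-(1 / (N : ℝ)))) =
            1 / 60 * N * (n : ℝ) ^ (-(1 / (N : ℝ))) := by ring
        rw [this, mul_pow, mul_pow, hpow]
        field_simp
    _ ≤ 2 * (1 / 60) ^ N * 3 ^ N := by
        gcongr
        rw [div_le_iff₀ hf]
        exact (pow_self_le_exp_one_pow_mul_factorial N).trans (by gcongr)
    _ = 2 * (1 / 20) ^ N := by rw [mul_assoc, ← mul_pow]; norm_num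
    _ ≤ 2 * (1 / 20) ^ 2 := by
        gcongr 2 * ?_
        exact pow_le_pow_of_le_one (by norm_num) (by norm_num) hN
    _ ≤ 0.01 := by norm_num

set_option maxHeartbeats 1600000 in
theorem mainTheorem1 :
    ∃ ε₀ : ℝ, 0 < ε₀ ∧ ∃ β : ℕ → ℝ → ℝ,
      ∀ A B c : ℝ, 0 < A → 0 < B → 0 < c →
        ∃ a C : ℝ, 0 < a ∧ 0 < C ∧ ∃ n₀ : ℕ,
          ∀ (n L : ℕ) (ε : ℝ), n₀ ≤ n →
            1 ≤ L → (L : ℝ) ≤ A * Real.log n →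
            c / n ≤ ε → ε ≤ ε₀ → Real.log (1 / ε) ≤ B * L →
            0 < β L ε ∧
            ∃ Hplus Hminus : PMF (Fin n → ℕ),
              IsHistogramLaw
                {p | IsBig (1 / (β L ε * n)) p ∧
                  ∀ i, (p i).toReal ≤ C * (L : ℝ) ^ 2 / (n * Real.log (1 / ε) ^ 2)}
                (a * ((n : ℝ) ^ (1 - 1 / (L : ℝ)) * Real.log (1 / ε) ^ 2 / L)) Hplus ∧
              IsHistogramLaw
                {p | IsFarFromBig ε (1 / (β L ε * n)) p ∧
                  ∀ i, (p i).toReal ≤ C * (L : ℝ) ^ 2 / (n * Real.log (1 / ε) ^ 2)}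
                (a * ((n : ℝ) ^ (1 - 1 / (L : ℝ)) * Real.log (1 / ε) ^ 2 / L)) Hminus ∧
              tvDist Hplus Hminus ≤ 0.01 := by
  -- β = 5 comes from the bound 5n on the total score. Since log(1/ε) ≥ 22, 20ε ≤ e^(5-ℓ) ≤
  -- e^(-(ℓ/2+6)) ≤ q.
  refine ⟨Real.exp (-22), Real.exp_pos _, fun _ _ => 5, fun A B c hA hB hc => ?_⟩
  -- The 8 gives 4L/r ≤ ℓ/2, and 2B gives r = κL/ℓ ≥ 2.
  set κ := 8 + 2 * B with hκ
  have hκ0 : 0 < κ := by positivity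
  set a' := 1 / (180 * κ ^ 2) with ha'
  have ha'0 : 0 < a' := by positivity
  obtain ⟨n₁, hn₁⟩ := eventually_mul_log_le_sqrt (10 * κ * A + 384 * A / a')
  refine ⟨a' / 32, 4 * κ ^ 2, by positivity, by positivity,
    max 1 (max n₁ ⌈48 ^ 2 * Real.exp 12 / c⌉₊), ?_⟩
  intro n L ε hn hL hLA hcε hεε hlog
  refine ⟨by norm_num, ?_⟩
  have hn1 : 1 ≤ n := (le_max_left _ _).trans hn
  have hn2 : n₁ ≤ n := ((le_max_left _ _).trans (le_max_right _ _)).trans hn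
  have hn3 : ⌈48 ^ 2 * Real.exp 12 / c⌉₊ ≤ n :=
    ((le_max_right _ _).trans (le_max_right _ _)).trans hn
  have hn4 : 48 ^ 2 * Real.exp 12 / c ≤ n := Nat.ceil_le.mp hn3
  have hn' : (0 : ℝ) < n := by exact_mod_cast hn1
  have hn1' : (1 : ℝ) ≤ n := by exact_mod_cast hn1
  have hL' : (1 : ℝ) ≤ L := by exact_mod_cast hL
  have hL0 : (0 : ℝ) < L := by linarith
  have hε : 0 < ε := (div_pos hc hn').trans_le hcε
  set ℓ := Real.log (1 / ε) with hℓ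
  have hεℓ : ε = Real.exp (-ℓ) := by
    rw [hℓ, one_div, Real.log_inv, neg_neg, Real.exp_log hε]
  have hℓ22 : 22 ≤ ℓ := by
    rw [hεℓ, Real.exp_le_exp] at hεε
    linarith
  have hℓ0 : 0 < ℓ := by linarith
  have hlog0 : 0 ≤ Real.log n := Real.log_nonneg hn1'
  have hsq := hn₁ n hn2
  have hsq1 : 10 * κ * A * Real.log n ≤ Real.sqrt n := by
    refine le_trans ?_ hsq
    gcongr
    have : 0 ≤ 384 * A / a' := by positivity
    linarith
  have hsq2 : 384 * A / a' * Real.log n ≤ Real.sqrt n := by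
    refine le_trans ?_ hsq
    gcongr
    have : 0 ≤ 10 * κ * A := by positivity
    linarith
  have hsqn : Real.sqrt n ^ 2 = n := Real.sq_sqrt hn'.le
  set r := κ * L / ℓ with hr
  have hr2 : 2 ≤ r := by
    rw [hr, le_div_iff₀ hℓ0, hκ]
    linarith
  have hr0 : 0 < r := by linarith
  obtain ⟨ι, _, x, wp, wm, hpair⟩ := exists_isMatchedPair L hr2
  set q := Real.exp (-(4 * L / r + 6)) with hq
  have hLr : 4 * L / r ≤ ℓ / 2 := by
    have e : 4 * L / r = 4 * ℓ / κ := by rw [hr]; field_simp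
    rw [e, div_le_div_iff₀ hκ0 (by norm_num), hκ]
    nlinarith [mul_pos hℓ0 hB]
  have hqℓ : Real.exp (-(ℓ / 2 + 6)) ≤ q := by
    rw [hq]; gcongr
  -- N is the first unmatched moment order; N ≥ 2 ensures n^(1-1/N) ≥ √n even when L = 1.
  set N := L + 1 with hN
  have hN2 : 2 ≤ N := by omega
  have hNL : (N : ℝ) = L + 1 := by rw [hN]; push_cast; ring
  have hN0 : (0 : ℝ) < N := by rw [hNL]; linarith
  set R := a' * ((n : ℝ) ^ (1 - 1 / (N : ℝ)) * ℓ ^ 2 / N) with hR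
  have hR0 : 0 < R := by positivity
  have hRn : R / n * n = R := div_mul_cancel₀ _ hn'.ne'
  have hs : a' / 32 * ((n : ℝ) ^ (1 - 1 / (L : ℝ)) * ℓ ^ 2 / L) ≤ R / n * n / 16 := by
    rw [hRn, hR]
    have h1 : (n : ℝ) ^ (1 - 1 / (L : ℝ)) ≤ (n : ℝ) ^ (1 - 1 / (N : ℝ)) := by
      apply Real.rpow_le_rpow_of_exponent_le hn1'
      have : 1 / (N : ℝ) ≤ 1 / L := by gcongr; linarith
      linarith
    have h2 : 1 / (L : ℝ) ≤ 2 / N := by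
      rw [div_le_div_iff₀ hL0 hN0]; linarith
    calc a' / 32 * ((n : ℝ) ^ (1 - 1 / (L : ℝ)) * ℓ ^ 2 / L)
        = a' / 32 * ((n : ℝ) ^ (1 - 1 / (L : ℝ)) * ℓ ^ 2 * (1 / L)) := by ring
      _ ≤ a' / 32 * ((n : ℝ) ^ (1 - 1 / (N : ℝ)) * ℓ ^ 2 * (2 / N)) := by gcongr
      _ = _ := by ring
  have hb : r ^ 2 = κ ^ 2 * L ^ 2 / ℓ ^ 2 := by rw [hr]; ring
  have hX1 : 12 ≤ n / (8 * r ^ 2) := by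
    rw [le_div_iff₀ (by positivity)]
    have h1 : r ≤ κ * (A * Real.log n) := by
      rw [hr, div_le_iff₀ hℓ0]
      calc κ * L ≤ κ * (A * Real.log n) * 1 := by rw [mul_one]; gcongr
        _ ≤ κ * (A * Real.log n) * ℓ := by gcongr; linarith
    have h2 : (10 * r) ^ 2 ≤ Real.sqrt n ^ 2 := by
      gcongr
      linarith
    rw [hsqn] at h2
    nlinarith [sq_nonneg r]
  have hX2 : 12 ≤ n * q / 4 := by
    -- Here e^(-ℓ/2) = √ε, so the square is n²ε e^(-12) ≥ cn e^(-12); this is where ε ≥ c/n enters.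
    have h1 : (48 : ℝ) ^ 2 ≤ (n * Real.exp (-(ℓ / 2 + 6))) ^ 2 := by
      have e : Real.exp (-(ℓ / 2 + 6)) ^ 2 = ε * Real.exp (-12) := by
        rw [hεℓ, ← Real.exp_add, ← Real.exp_nat_mul]
        congr 1
        push_cast
        ring
      rw [mul_pow, e]
      rw [div_le_iff₀ hn'] at hcε
      rw [div_le_iff₀ hc] at hn4
      have e2 : Real.exp 12 * Real.exp (-12) = 1 := by rw [← Real.exp_add]; simp
      calc (48 : ℝ) ^ 2 = 48 ^ 2 * Real.exp 12 * Real.exp (-12) := by rw [mul_assoc, e2, mul_one]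
        _ ≤ n * c * Real.exp (-12) := by gcongr
        _ ≤ n * (ε * n) * Real.exp (-12) := by gcongr
        _ = _ := by ring
    have h2 : 48 ≤ n * Real.exp (-(ℓ / 2 + 6)) :=
      le_of_sq_le_sq h1 (by positivity)
    have h3 : n * Real.exp (-(ℓ / 2 + 6)) ≤ n * q := by gcongr
    linarith
  have hX3 : 12 ≤ R / n * n / 16 := by
    rw [hRn, le_div_iff₀ (by norm_num), hR]
    have h1 : Real.sqrt n ≤ (n : ℝ) ^ (1 - 1 / (N : ℝ)) := by
      rw [Real.sqrt_eq_rpow]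
      apply Real.rpow_le_rpow_of_exponent_le hn1'
      have : 1 / (N : ℝ) ≤ 1 / 2 := by
        gcongr
        exact_mod_cast hN2
      linarith
    have h2 : (N : ℝ) ≤ 2 * (A * Real.log n) := by rw [hNL]; linarith
    have h3 : 192 * N ≤ a' * Real.sqrt n := by
      rw [div_mul_eq_mul_div, div_le_iff₀ ha'0] at hsq2
      linarith
    calc (12 : ℝ) * 16 = 192 * N / N := by field_simp; norm_num
      _ ≤ a' * Real.sqrt n / N := by gcongr
      _ ≤ a' * ((n : ℝ) ^ (1 - 1 / (N : ℝ)) * ℓ ^ 2) / N := by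
          gcongr
          calc Real.sqrt n ≤ (n : ℝ) ^ (1 - 1 / (N : ℝ)) * 1 := by rw [mul_one]; exact h1
            _ ≤ _ := by gcongr; nlinarith
      _ = _ := by ring
  have hmain := exists_histogramLaws_of_isMatchedPair hL hpair hn1 (ρ := R / n) (ε := ε)
    (s := a' / 32 * ((n : ℝ) ^ (1 - 1 / (L : ℝ)) * ℓ ^ 2 / L)) (by positivity)
    (Real.exp_nonneg _) (by positivity) ?_ hs ?_ ?_
  · have e : 4 * r ^ 2 / n = 4 * κ ^ 2 * (L : ℝ) ^ 2 / (n * ℓ ^ 2) := by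
      rw [hb]; field_simp
    rw [e] at hmain
    exact hmain
  · refine le_trans ?_ hqℓ
    rw [hεℓ]
    have h1 : (2 : ℝ) ^ 5 ≤ Real.exp 1 ^ 5 := by
      gcongr
      linarith [Real.add_one_le_exp 1]
    rw [← Real.exp_nat_mul] at h1
    norm_num at h1
    calc 20 * Real.exp (-ℓ) ≤ Real.exp 5 * Real.exp (-ℓ) := by gcongr; linarith
      _ = Real.exp (5 - ℓ) := by rw [← Real.exp_add]; ring_nf
      _ ≤ Real.exp (-(ℓ / 2 + 6)) := by
          gcongr
          linarith
  · have h1 := exp_neg_le_of_twelve_le hX1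
    have h2 := exp_neg_le_of_twelve_le hX2
    have h3 := exp_neg_le_of_twelve_le hX3
    linarith
  · refine mul_pow_div_factorial_le hn1 hN2 (by positivity) ?_
    have e1 : (n : ℝ) ^ (1 - 1 / (N : ℝ)) = n * (n : ℝ) ^ (-(1 / (N : ℝ))) := by
      rw [sub_eq_add_neg, Real.rpow_add hn', Real.rpow_one]
    have e2 : R / n * r ^ 2 = 1 / 180 * (L ^ 2 / N) * (n : ℝ) ^ (-(1 / (N : ℝ))) := by
      rw [hR, hb, e1, ha']
      field_simp
    rw [e2]
    gcongr
    rw [div_le_iff₀ hN0, hNL]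
    nlinarith
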